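/- Let $E=(E^0,E^1,s,r)$ be a directed graph with $E^0\neq\varnothing$ which is row-finite, i.e. $s^{-1}(v)$ is finite for every $v\in E^0$, and let $S$ be a commutative semiring (with $0$ and $1$; additive inverses are not required). The Leavitt path algebra $L_S(E)$ is the (not necessarily unital) associative $S$-algebra generated by $E^0\cup E^1\cup\{e^*\mid e\in E^1\}$ subject to the relations 1. $vw=\delta_{v,w}v$ for all $v,w\in E^0$; 2. $s(e)e=e=e\,r(e)$ and $r(e)e^*=e^*=e^*s(e)$ for all $e\in E^1$; 3. $e^*f=\delta_{e,f}\,r(e)$ for all $e,f\in E^1$; 4. $v=\sum_{e\in s^{-1}(v)}ee^*$ for every regular vertex $v$, i.e. every $v\in E^0$ with $0<|s^{-1}(v)|<\infty$. A hemiring (semiring possibly without identity) is congruence-simple if it is nonzero and its only congruences (equivalence relations compatible with addition and multiplication) are the diagonal and the universal one. Then $L_S(E)$ is congruence-simple if and only if the following three conditions hold: (1) $S$ is either a field or isomorphic to the Boolean semifield $\mathbb B=(\{0,1\},\vee,\wedge)$; (2) the only hereditary and saturated subsets of $E^0$ are $\varnothing$ and $E^0$, where $H\subseteq E^0$ is hereditary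 if $s(e)\in H$ implies $r(e)\in H$ for all $e\in E^1$, and saturated if $v\in H$ for every regular vertex $v$ with $r(s^{-1}(v))\subseteq H$; (3) every cycle in $E$ has an exit, where a cycle is a sequence $e_1\cdots e_n$ of edges ($n\ge 1$) with $r(e_i)=s(e_{i+1})$ for $1\le i<n$, $r(e_n)=s(e_1)$ and $s(e_1),\dots,s(e_n)$ distinct, and an exit for it is an edge $f$ with $s(f)=s(e_i)$ and $f\neq e_i$ for some $i$. -/

import Mathlib

/-- A directed graph with vertex set `V`, edge set `E`, and source and range maps. -/
structure DirGraph (V E : Type*) where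
  source : E → V
  range : E → V

namespace DirGraph

variable {V E : Type*} (G : DirGraph V E)

/-- Every vertex emits only finitely many edges. -/
def RowFinite : Prop := ∀ v, {e | G.source e = v}.Finite

/-- A vertex is regular if it emits at least one and only finitely many edges. -/
def IsRegular (v : V) : Prop :=
  {e | G.source e = v}.Nonempty ∧ {e | G.source e = v}.Finite

def IsHereditary (H : Set V) : Prop := ∀ e, G.source e ∈ H → G.range e ∈ H

def IsSaturated (H : Set V) : Prop :=
  ∀ v, G.IsRegular v → (∀ e, G.source e = v → G.range e ∈ H) → v ∈ H

/-- `p = e₁ ⋯ eₙ` with `n ≥ 1` is a path if `r(eᵢ) = s(eᵢ₊₁)` for all `i`; it is a cycle if moreover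
`r(eₙ) = s(e₁)` and the vertices `s(e₁), …, s(eₙ)` are distinct. -/
def IsCycle (p : List E) : Prop :=
  p.IsChain (fun e f => G.range e = G.source f) ∧
  (∃ h : p ≠ [], G.range (p.getLast h) = G.source (p.head h)) ∧
  (p.map G.source).Nodup

/-- `f` is an exit for the path `p = e₁ ⋯ eₙ`: for some `i`, `s(f) = s(eᵢ)` but `f ≠ eᵢ`. -/
def IsExit (f : E) (p : List E) : Prop := ∃ e ∈ p, G.source f = G.source e ∧ f ≠ e

end DirGraph

/-- The Boolean semifield: `{0, 1}` with addition `∨` and multiplication `∧`. -/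
inductive BoolSemifield
  | zero
  | one

namespace BoolSemifield

def add : BoolSemifield → BoolSemifield → BoolSemifield
  | zero, b => b
  | one, _ => one

def mul : BoolSemifield → BoolSemifield → BoolSemifield
  | zero, _ => zero
  | one, b => b

instance : Zero BoolSemifield := ⟨zero⟩

instance : One BoolSemifield := ⟨one⟩

instance : Add BoolSemifield := ⟨add⟩

instance : Mul BoolSemifield := ⟨mul⟩

instance : CommSemiring BoolSemifield where
  nsmul := nsmulRec
  npow := npowRec
  add_assoc := by rintro ⟨⟩ ⟨⟩ ⟨⟩ <;> rfl
  zero_add := by rintro ⟨⟩ <;> rfl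
  add_zero := by rintro ⟨⟩ <;> rfl
  add_comm := by rintro ⟨⟩ ⟨⟩ <;> rfl
  left_distrib := by rintro ⟨⟩ ⟨⟩ ⟨⟩ <;> rfl
  right_distrib := by rintro ⟨⟩ ⟨⟩ ⟨⟩ <;> rfl
  zero_mul := by rintro ⟨⟩ <;> rfl
  mul_zero := by rintro ⟨⟩ <;> rfl
  mul_assoc := by rintro ⟨⟩ ⟨⟩ ⟨⟩ <;> rfl
  one_mul := by rintro ⟨⟩ <;> rfl
  mul_one := by rintro ⟨⟩ <;> rfl
  mul_comm := by rintro ⟨⟩ ⟨⟩ <;> rfl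

end BoolSemifield

/-- A commutative semiring is a field if it is nontrivial, its nonzero elements are invertible (these
two are `IsField`, which over a semiring only says semifield), and it has additive inverses. -/
def IsFieldSemiring (S : Type*) [CommSemiring S] : Prop :=
  IsField S ∧ ∀ a : S, ∃ b : S, a + b = 0

/-- A hemiring (no identity element required) is congruence-simple if it is nonzero and its only
congruences are the diagonal one `⊥` and the universal one `⊤`. -/
def IsCongruenceSimple (A : Type*) [NonUnitalSemiring A] : Prop :=
  Nontrivial A ∧ ∀ ρ : RingCon A, ρ = ⊥ ∨ ρ = ⊤

namespace LeavittPath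

/-- The generators `v`, `e`, `e*`. -/
inductive Gen (V E : Type*)
  | vertex (v : V)
  | edge (e : E)
  | ghost (e : E)

/-- The free (not necessarily unital) associative `S`-algebra on the generators: the semigroup algebra
of the free semigroup of nonempty words. -/
abbrev FreeAlg (S V E : Type*) [CommSemiring S] := MonoidAlgebra S (FreeSemigroup (Gen V E))

section

variable (S : Type*) {V E : Type*} [CommSemiring S]

noncomputable def gen (x : Gen V E) : FreeAlg S V E := MonoidAlgebra.single (FreeSemigroup.of x) 1

noncomputable def vtx (v : V) : FreeAlg S V E := gen S (Gen.vertex v)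

noncomputable def edg (e : E) : FreeAlg S V E := gen S (Gen.edge e)

noncomputable def gho (e : E) : FreeAlg S V E := gen S (Gen.ghost e)

/-- The defining relations of the Leavitt path algebra. -/
inductive Rel (G : DirGraph V E) : FreeAlg S V E → FreeAlg S V E → Prop
  | vertex_mul_self (v : V) : Rel G (vtx S v * vtx S v) (vtx S v)
  | vertex_mul_of_ne (v w : V) (h : v ≠ w) : Rel G (vtx S v * vtx S w) 0
  | source_mul_edge (e : E) : Rel G (vtx S (G.source e) * edg S e) (edg S e)
  | edge_mul_range (e : E) : Rel G (edg S e * vtx S (G.range e)) (edg S e)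
  | range_mul_ghost (e : E) : Rel G (vtx S (G.range e) * gho S e) (gho S e)
  | ghost_mul_source (e : E) : Rel G (gho S e * vtx S (G.source e)) (gho S e)
  | ghost_mul_edge_self (e : E) : Rel G (gho S e * edg S e) (vtx S (G.range e))
  | ghost_mul_edge_of_ne (e f : E) (h : e ≠ f) : Rel G (gho S e * edg S f) 0
  | vertex_eq_sum (v : V) (h : G.IsRegular v) :
      Rel G (vtx S v) (∑ e ∈ h.2.toFinset, edg S e * gho S e)

/-- The `S`-algebra congruence generated by the defining relations, i.e. the least congruence of the
underlying hemiring that contains all scalar multiples of the defining pairs. -/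
noncomputable def con (G : DirGraph V E) : RingCon (FreeAlg S V E) :=
  ringConGen fun a b => ∃ (c : S) (x y : FreeAlg S V E), Rel S G x y ∧ a = c • x ∧ b = c • y

theorem con_smul (G : DirGraph V E) (c : S) {a b : FreeAlg S V E} (h : con S G a b) :
    con S G (c • a) (c • b) := by
  have h' : RingConGen.Rel (fun a b => ∃ (c : S) (x y : FreeAlg S V E),
      Rel S G x y ∧ a = c • x ∧ b = c • y) a b := h
  change RingConGen.Rel _ _ _
  clear h
  induction h' with
  | of x y h =>
    obtain ⟨d, x, y, hr, rfl, rfl⟩ := h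
    exact .of _ _ ⟨c * d, x, y, hr, smul_smul _ _ _, smul_smul _ _ _⟩
  | refl x => exact .refl _
  | symm h ih => exact ih.symm
  | trans h₁ h₂ ih₁ ih₂ => exact ih₁.trans ih₂
  | add h₁ h₂ ih₁ ih₂ =>
    rw [smul_add, smul_add]
    exact ih₁.add ih₂
  | mul h₁ h₂ ih₁ ih₂ =>
    rw [← smul_mul_assoc, ← smul_mul_assoc]
    exact ih₁.mul h₂

end

end LeavittPath

/-- The Leavitt path algebra `L_S(G)` of the directed graph `G` over the commutative semiring `S`. -/
def LeavittPathAlgebra (S : Type*) [CommSemiring S] {V E : Type*} (G : DirGraph V E) :=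
  (LeavittPath.con S G).Quotient

namespace LeavittPathAlgebra

variable (S : Type*) [CommSemiring S] {V E : Type*} (G : DirGraph V E)

noncomputable instance : NonUnitalSemiring (LeavittPathAlgebra S G) :=
  inferInstanceAs (NonUnitalSemiring (LeavittPath.con S G).Quotient)

/-- The quotient map from the free algebra. -/
noncomputable def mk (a : LeavittPath.FreeAlg S V E) : LeavittPathAlgebra S G :=
  RingCon.toQuotient (c := LeavittPath.con S G) a

noncomputable instance : SMul S (LeavittPathAlgebra S G) where
  smul c := Quotient.map (c • ·) fun _ _ h => LeavittPath.con_smul S G c h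

theorem mk_surjective : Function.Surjective (mk S G) := Quotient.mk_surjective

noncomputable instance : Module S (LeavittPathAlgebra S G) where
  one_smul := (mk_surjective S G).forall.2 fun a => congrArg (mk S G) (one_smul S a)
  mul_smul c d := (mk_surjective S G).forall.2 fun a => congrArg (mk S G) (mul_smul c d a)
  smul_zero c := congrArg (mk S G) (smul_zero c)
  smul_add c := (mk_surjective S G).forall₂.2 fun a b => congrArg (mk S G) (smul_add c a b)
  add_smul c d := (mk_surjective S G).forall.2 fun a => congrArg (mk S G) (add_smul c d a)
  zero_smul := (mk_surjective S G).forall.2 fun a => congrArg (mk S G) (zero_smul S a)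

instance : IsScalarTower S (LeavittPathAlgebra S G) (LeavittPathAlgebra S G) where
  smul_assoc c := (mk_surjective S G).forall₂.2 fun a b => congrArg (mk S G) (smul_mul_assoc c a b)

instance : SMulCommClass S (LeavittPathAlgebra S G) (LeavittPathAlgebra S G) where
  smul_comm c := (mk_surjective S G).forall₂.2 fun a b =>
    congrArg (mk S G) (mul_smul_comm c a b).symm

end LeavittPathAlgebra

/-! Necessity. Every hereditary saturated `H` gives representations of `L_S(E)` on the `M`-valued
functions on `(V \ H) × ℤ`, whose points behave like boundary paths of the graph outside `H`
(`DirGraph.exists_branchingSystem`, `BranchingSystem.exists_rep`). If the algebra is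
congruence-simple, each kernel congruence is trivial or universal, and suitable choices of data
force the three conditions. Values in `S ⧸ ρ` transfer simplicity to `S`. A proper nonempty `H`
gives a kernel killing exactly the vertices in `H`. Along a cycle without exit the fibre shift `k`
is free: for `k = 0` the cycle acts as its base vertex, for `k = 1` it does not.

Sufficiency. Subtraction is unavailable, so the reduction is carried out on a pair `x ≠ y` related
by a congruence `ρ`. Right multiplication by edges removes ghost edges while keeping the pair
distinct (`exists_rel_ne_mem_zero`). The pair then consists of combinations of real paths, with
different coefficients `a ≠ b` at some path `p`. Since cycles have exits, there is a tail `m` making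
`p m` incomparable with the finitely many competing `q m`, so `z ↦ (p m)* z m` isolates that
coefficient and gives `a v ρ b v` (`exists_rel_smul_vertex`). Simplicity of `S` turns this into `v ρ
0`. The vertices related to `0` form a hereditary saturated set, hence all of `V`, and local units
make `ρ` universal.

Condition (1) is the classification of congruence-simple commutative semirings,
`isCongruenceSimple_iff_isFieldSemiring_or_bool`. -/

theorem RingCon.eq_top_of_one_zero {R : Type*} [Semiring R] {ρ : RingCon R} (h : ρ 1 0) : ρ = ⊤ := by
  have h0 : ∀ x, ρ x 0 := fun x => by simpa using ρ.mul (ρ.refl x) h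
  ext x y
  exact ⟨fun _ => trivial, fun _ => ρ.trans (h0 x) (ρ.symm (h0 y))⟩

theorem RingCon.eq_bot_of_forall {R : Type*} [Add R] [Mul R] {ρ : RingCon R}
    (h : ∀ x y, ρ x y → x = y) : ρ = ⊥ := by
  ext x y
  exact ⟨fun hxy => h x y hxy, fun hxy => (show x = y from hxy) ▸ ρ.refl x⟩

theorem isCongruenceSimple_iff {A : Type*} [NonUnitalSemiring A] :
    IsCongruenceSimple A ↔ Nontrivial A ∧ ∀ ρ : RingCon A,
      (∀ x y, ρ x y → x = y) ∨ (∀ x y, ρ x y) := by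
  refine and_congr_right fun _ => forall_congr' fun ρ => or_congr ?_ ?_
  · exact ⟨fun h x y hxy => by subst h; exact hxy, RingCon.eq_bot_of_forall⟩
  · refine ⟨fun h x y => by subst h; trivial, fun h => ?_⟩
    ext x y
    exact ⟨fun _ => trivial, fun _ => h x y⟩

theorem BoolSemifield.eq_zero_or_one (b : BoolSemifield) : b = 0 ∨ b = 1 := by
  cases b
  · exact Or.inl rfl
  · exact Or.inr rfl

/-! ### Congruence-simple commutative semirings. -/

section CommSemiring

variable {S : Type*} [CommSemiring S]

theorem IsFieldSemiring.isCongruenceSimple (h : IsFieldSemiring S) : IsCongruenceSimple S := by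
  obtain ⟨hf, hneg⟩ := h
  refine ⟨⟨hf.exists_pair_ne⟩, fun ρ => or_iff_not_imp_left.2 fun hρ => ?_⟩
  have : ∃ a b, ρ a b ∧ a ≠ b := by
    by_contra! h
    exact hρ (RingCon.eq_bot_of_forall h)
  obtain ⟨a, b, hab, hne⟩ := this
  obtain ⟨c, hc⟩ := hneg b
  have h0 : ρ (a + c) 0 := hc ▸ ρ.add hab (ρ.refl c)
  have hne' : a + c ≠ 0 := fun h => hne <| by
    calc a = a + (b + c) := by rw [hc, add_zero]
      _ = b + (a + c) := by ring
      _ = b := by rw [h, add_zero]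
  obtain ⟨d, hd⟩ := hf.mul_inv_cancel hne'
  apply RingCon.eq_top_of_one_zero
  simpa [hd] using ρ.mul h0 (ρ.refl d)

theorem isCongruenceSimple_of_equiv_bool (φ : S ≃+* BoolSemifield) : IsCongruenceSimple S := by
  have h01 : ∀ x : S, x = 0 ∨ x = 1 := fun x => by
    rcases (φ x).eq_zero_or_one with h | h
    · exact Or.inl (φ.injective (h.trans (map_zero φ).symm))
    · exact Or.inr (φ.injective (h.trans (map_one φ).symm))
  have hne : (1 : S) ≠ 0 := fun h => by
    have := congrArg φ h
    rw [map_zero, map_one] at this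
    exact BoolSemifield.noConfusion this
  refine ⟨⟨1, 0, hne⟩, fun ρ => or_iff_not_imp_left.2 fun hρ => ?_⟩
  have : ∃ a b, ρ a b ∧ a ≠ b := by
    by_contra! h
    exact hρ (RingCon.eq_bot_of_forall h)
  obtain ⟨a, b, hab, hab'⟩ := this
  apply RingCon.eq_top_of_one_zero
  rcases h01 a with rfl | rfl <;> rcases h01 b with rfl | rfl
  · exact absurd rfl hab'
  · exact ρ.symm hab
  · exact hab
  · exact absurd rfl hab'

/-- The congruence `a * x = a * y`. -/
def mulLeftCon (a : S) : RingCon S where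
  r x y := a * x = a * y
  iseqv := ⟨fun _ => rfl, fun h => h.symm, fun h₁ h₂ => h₁.trans h₂⟩
  add' h₁ h₂ := by simp only [mul_add, *]
  mul' {w x y z} h₁ h₂ := by
    calc a * (w * y) = a * w * y := by ring
      _ = x * (a * y) := by rw [h₁]; ring
      _ = a * (x * z) := by rw [h₂]; ring

/-- The congruence of differing by an additively invertible multiple of `a`. -/
def addUnitsCon (a : S) : RingCon S where
  r x y := ∃ u u', a * u + a * u' = 0 ∧ x = y + a * u
  iseqv :=
    { refl := fun x => ⟨0, 0, by simp, by simp⟩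
      symm := by
        rintro x y ⟨u, u', h, rfl⟩
        exact ⟨u', u, by rwa [add_comm], by rw [add_assoc, h, add_zero]⟩
      trans := by
        rintro x y z ⟨u, u', h, rfl⟩ ⟨w, w', h', rfl⟩
        refine ⟨u + w, u' + w', ?_, by ring⟩
        calc a * (u + w) + a * (u' + w') = (a * u + a * u') + (a * w + a * w') := by ring
          _ = 0 := by rw [h, h', add_zero] }
  add' := by
    rintro _ x _ y ⟨u, u', h, rfl⟩ ⟨w, w', h', rfl⟩
    refine ⟨u + w, u' + w', ?_, by ring⟩
    calc a * (u + w) + a * (u' + w') = (a * u + a * u') + (a * w + a * w') := by ring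
      _ = 0 := by rw [h, h', add_zero]
  mul' := by
    rintro _ x _ y ⟨u, u', h, rfl⟩ ⟨w, w', h', rfl⟩
    refine ⟨x * w + u * y + u * a * w, x * w' + u' * y + u' * a * w, ?_, by ring⟩
    calc a * (x * w + u * y + u * a * w) + a * (x * w' + u' * y + u' * a * w)
        = x * (a * w + a * w') + (a * u + a * u') * (y + a * w) := by ring
      _ = 0 := by rw [h, h', mul_zero, zero_mul, add_zero]

/-- Simplicity first gives multiplicative cancellation. The dichotomy is whether `1` has a negative:
if so, congruence modulo a principal ideal produces inverses; if not, the semiring has no nontrivial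
zero sums, and collapsing all nonzero elements is a congruence that must be the diagonal. -/
theorem IsCongruenceSimple.isFieldSemiring_or_bool (h : IsCongruenceSimple S) :
    IsFieldSemiring S ∨ Nonempty (S ≃+* BoolSemifield) := by
  obtain ⟨hnt, h⟩ := isCongruenceSimple_iff.1 h
  have hcancel : ∀ a : S, a ≠ 0 → ∀ x y, a * x = a * y → x = y := fun a ha => by
    rcases h (mulLeftCon a) with h | h
    · exact h
    · have : a * 1 = a * 0 := h 1 0
      exact absurd (by simpa using this) ha
  by_cases hone : ∃ b : S, 1 + b = 0
  · obtain ⟨b, hb⟩ := hone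
    have hneg : ∀ a : S, a + a * b = 0 := fun a => by
      rw [← mul_one_add, hb, mul_zero]
    refine Or.inl ⟨⟨hnt.exists_pair_ne, mul_comm, fun {a} ha => ?_⟩, fun a => ⟨_, hneg a⟩⟩
    -- All negatives exist here, so this is congruence modulo the ideal `aS`; being universal it
    -- relates `1` to `0`, that is, `1 = a * u`.
    rcases h (addUnitsCon a) with h | h
    · exact absurd (h a 0 ⟨1, b, by simpa using hneg a, by simp⟩) ha
    · obtain ⟨u, -, -, hu⟩ := h 1 0
      exact ⟨u, by simpa using hu.symm⟩
  · have hsum : ∀ a b : S, a + b = 0 → a = 0 := fun a b hab => by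
      -- This relation identifies additively invertible elements with `0`. If it were universal, `1`
      -- itself would have a negative.
      rcases h (addUnitsCon 1) with h | h
      · exact h a 0 ⟨a, b, by simpa using hab, by simp⟩
      · obtain ⟨u, u', hu, hu'⟩ := h 1 0
        refine absurd ⟨u', ?_⟩ hone
        simp only [zero_add, one_mul] at hu hu'
        rwa [hu']
    have hsum' : ∀ a b : S, a + b = 0 ↔ a = 0 ∧ b = 0 := fun a b =>
      ⟨fun h => ⟨hsum a b h, hsum b a (by rwa [add_comm])⟩, by rintro ⟨rfl, rfl⟩; simp⟩
    have hmul : ∀ a b : S, a * b = 0 ↔ a = 0 ∨ b = 0 := fun a b => by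
      refine ⟨fun h => or_iff_not_imp_left.2 fun ha => hcancel a ha _ _ (by simpa using h), ?_⟩
      rintro (rfl | rfl) <;> simp
    let ρ : RingCon S :=
      { r := fun x y => x = 0 ↔ y = 0
        iseqv := ⟨fun _ => Iff.rfl, fun h => h.symm, fun h₁ h₂ => h₁.trans h₂⟩
        add' := fun {w x y z} h₁ h₂ => by
          rw [hsum', hsum', h₁, h₂]
        mul' := fun {w x y z} h₁ h₂ => by
          rw [hmul, hmul, h₁, h₂] }
    rcases h ρ with h | h
    · classical
      let φ : S →+* BoolSemifield :=
        { toFun := fun x => if x = 0 then 0 else 1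
          map_zero' := by simp
          map_one' := by simp
          map_add' := fun x y => by
            simp only [hsum']
            by_cases hx : x = 0
            · simp [hx]
            · simp only [hx, false_and, if_false]
              rfl
          map_mul' := fun x y => by
            simp only [hmul]
            by_cases hx : x = 0 <;> by_cases hy : y = 0 <;> simp [hx, hy] }
      have h10 : (1 : BoolSemifield) ≠ 0 := fun h => BoolSemifield.noConfusion h
      refine Or.inr ⟨RingEquiv.ofBijective φ ⟨fun x y hxy => h x y ?_, fun b => ?_⟩⟩
      · change (if x = 0 then (0 : BoolSemifield) else 1) = if y = 0 then 0 else 1 at hxy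
        change x = 0 ↔ y = 0
        refine ⟨fun hx => by_contra fun hy => ?_, fun hy => by_contra fun hx => ?_⟩
        · rw [if_pos hx, if_neg hy] at hxy
          exact h10 hxy.symm
        · rw [if_neg hx, if_pos hy] at hxy
          exact h10 hxy
      · rcases b.eq_zero_or_one with rfl | rfl
        · exact ⟨0, map_zero φ⟩
        · exact ⟨1, map_one φ⟩
    · exact absurd ((h 1 0).2 rfl) one_ne_zero

theorem isCongruenceSimple_iff_isFieldSemiring_or_bool :
    IsCongruenceSimple S ↔ IsFieldSemiring S ∨ Nonempty (S ≃+* BoolSemifield) :=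
  ⟨fun h => h.isFieldSemiring_or_bool,
    fun h => h.elim (·.isCongruenceSimple) fun ⟨φ⟩ => isCongruenceSimple_of_equiv_bool φ⟩

end CommSemiring

/-! ### Relations, spanning words and the universal property. -/

namespace LeavittPathAlgebra

variable {S V E : Type*} [CommSemiring S] {G : DirGraph V E}

variable (S G) in
/-- The image of a vertex. -/
noncomputable def vertex (v : V) : LeavittPathAlgebra S G := mk S G (LeavittPath.vtx S v)

variable (S G) in
/-- The image of an edge. -/
noncomputable def edge (e : E) : LeavittPathAlgebra S G := mk S G (LeavittPath.edg S e)

variable (S G) in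
/-- The image of a ghost edge. -/
noncomputable def ghost (e : E) : LeavittPathAlgebra S G := mk S G (LeavittPath.gho S e)

theorem mk_mul (a b : LeavittPath.FreeAlg S V E) : mk S G (a * b) = mk S G a * mk S G b := rfl

theorem mk_smul (c : S) (a : LeavittPath.FreeAlg S V E) : mk S G (c • a) = c • mk S G a := rfl

variable (S G) in
/-- The quotient map as a homomorphism of additive monoids. -/
noncomputable def mkAddHom : LeavittPath.FreeAlg S V E →+ LeavittPathAlgebra S G where
  toFun := mk S G
  map_zero' := rfl
  map_add' _ _ := rfl

theorem mk_eq_of_rel {a b : LeavittPath.FreeAlg S V E} (h : LeavittPath.Rel S G a b) :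
    mk S G a = mk S G b :=
  Quotient.sound (RingConGen.Rel.of a b ⟨1, a, b, h, (one_smul S a).symm, (one_smul S b).symm⟩)

@[simp] theorem vertex_mul_self (v : V) : vertex S G v * vertex S G v = vertex S G v :=
  mk_eq_of_rel (.vertex_mul_self v)

theorem vertex_mul_of_ne {v w : V} (h : v ≠ w) : vertex S G v * vertex S G w = 0 :=
  mk_eq_of_rel (.vertex_mul_of_ne v w h)

@[simp] theorem source_mul_edge (e : E) : vertex S G (G.source e) * edge S G e = edge S G e :=
  mk_eq_of_rel (.source_mul_edge e)

@[simp] theorem edge_mul_range (e : E) : edge S G e * vertex S G (G.range e) = edge S G e :=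
  mk_eq_of_rel (.edge_mul_range e)

@[simp] theorem range_mul_ghost (e : E) : vertex S G (G.range e) * ghost S G e = ghost S G e :=
  mk_eq_of_rel (.range_mul_ghost e)

@[simp] theorem ghost_mul_source (e : E) : ghost S G e * vertex S G (G.source e) = ghost S G e :=
  mk_eq_of_rel (.ghost_mul_source e)

@[simp] theorem ghost_mul_edge_self (e : E) :
    ghost S G e * edge S G e = vertex S G (G.range e) :=
  mk_eq_of_rel (.ghost_mul_edge_self e)

theorem ghost_mul_edge_of_ne {e f : E} (h : e ≠ f) : ghost S G e * edge S G f = 0 :=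
  mk_eq_of_rel (.ghost_mul_edge_of_ne e f h)

theorem vertex_eq_sum {v : V} (h : G.IsRegular v) :
    vertex S G v = ∑ e ∈ h.2.toFinset, edge S G e * ghost S G e :=
  (mk_eq_of_rel (.vertex_eq_sum v h)).trans (map_sum (mkAddHom S G) _ _)

theorem vertex_mul_edge_of_ne {v : V} {e : E} (h : v ≠ G.source e) :
    vertex S G v * edge S G e = 0 := by
  rw [← source_mul_edge, ← mul_assoc, vertex_mul_of_ne h, zero_mul]

theorem edge_mul_vertex_of_ne {v : V} {e : E} (h : G.range e ≠ v) :
    edge S G e * vertex S G v = 0 := by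
  rw [← edge_mul_range, mul_assoc, vertex_mul_of_ne h, mul_zero]

theorem ghost_mul_vertex_of_ne {v : V} {e : E} (h : G.source e ≠ v) :
    ghost S G e * vertex S G v = 0 := by
  rw [← ghost_mul_source, mul_assoc, vertex_mul_of_ne h, mul_zero]

/-- The algebra is spanned by the words in its generators. -/
theorem induction_mul_right {C : LeavittPathAlgebra S G → Prop}
    (zero : C 0) (add : ∀ x y, C x → C y → C (x + y)) (smul : ∀ (c : S) x, C x → C (c • x))
    (vertex' : ∀ v, C (vertex S G v)) (edge' : ∀ e, C (edge S G e))
    (ghost' : ∀ e, C (ghost S G e)) (mul_vertex : ∀ x v, C x → C (x * vertex S G v))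
    (mul_edge : ∀ x e, C x → C (x * edge S G e)) (mul_ghost : ∀ x e, C x → C (x * ghost S G e))
    (x : LeavittPathAlgebra S G) : C x := by
  obtain ⟨a, rfl⟩ := mk_surjective S G x
  have gen : ∀ g, C (mk S G (LeavittPath.gen S g))
    | .vertex v => vertex' v
    | .edge e => edge' e
    | .ghost e => ghost' e
  have mul_gen : ∀ x g, C x → C (x * mk S G (LeavittPath.gen S g))
    | x, .vertex v => mul_vertex x v
    | x, .edge e => mul_edge x e
    | x, .ghost e => mul_ghost x e
  -- Word induction peels off the first letter, while the hypotheses append letters on the right;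
  -- quantifying over a left factor `y` reconciles the two.
  have word : ∀ w : FreeSemigroup (LeavittPath.Gen V E),
      ∀ y, C y → C (y * mk S G (MonoidAlgebra.single w 1)) := fun w => by
    induction w with
    | ih1 g => exact fun y hy => mul_gen y g hy
    | ih2 g w _ ih =>
      intro y hy
      have : (MonoidAlgebra.single (FreeSemigroup.of g * w) 1 : LeavittPath.FreeAlg S V E) =
        LeavittPath.gen S g * MonoidAlgebra.single w 1 := by
          simp [LeavittPath.gen, MonoidAlgebra.single_mul_single]
      rw [this, mk_mul, ← mul_assoc]
      exact ih _ (mul_gen y g hy)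
  have word' : ∀ w : FreeSemigroup (LeavittPath.Gen V E),
      C (mk S G (MonoidAlgebra.single w 1)) := fun w => by
    induction w with
    | ih1 g => exact gen g
    | ih2 g w _ _ =>
      have : (MonoidAlgebra.single (FreeSemigroup.of g * w) 1 : LeavittPath.FreeAlg S V E) =
        LeavittPath.gen S g * MonoidAlgebra.single w 1 := by
          simp [LeavittPath.gen, MonoidAlgebra.single_mul_single]
      rw [this, mk_mul]
      exact word w _ (gen g)
  induction a using MonoidAlgebra.induction_linear with
  | zero => exact zero
  | add a b ha hb => exact add _ _ ha hb
  | single w c =>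
    have : (MonoidAlgebra.single w c : LeavittPath.FreeAlg S V E) =
        c • MonoidAlgebra.single w 1 := by simp
    rw [this, mk_smul]
    exact smul _ _ (word' w)

section lift

variable {A : Type*} [NonUnitalSemiring A] [Module S A] [IsScalarTower S A A] [SMulCommClass S A A]

/-- The homomorphism on the free algebra given by images of the generators. -/
noncomputable def freeLift (g : LeavittPath.Gen V E → A) : LeavittPath.FreeAlg S V E →ₙₐ[S] A :=
  MonoidAlgebra.liftMagma S (FreeSemigroup.lift g)

theorem freeLift_gen (g : LeavittPath.Gen V E → A) (x : LeavittPath.Gen V E) :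
    freeLift g (LeavittPath.gen S x) = g x := by
  simp [freeLift, LeavittPath.gen]

/-- The universal property of the Leavitt path algebra. -/
theorem exists_hom (p : V → A) (q q' : E → A)
    (vv : ∀ v, p v * p v = p v) (vw : ∀ v w, v ≠ w → p v * p w = 0)
    (se : ∀ e, p (G.source e) * q e = q e) (er : ∀ e, q e * p (G.range e) = q e)
    (re : ∀ e, p (G.range e) * q' e = q' e) (es : ∀ e, q' e * p (G.source e) = q' e)
    (ee : ∀ e, q' e * q e = p (G.range e)) (ef : ∀ e f, e ≠ f → q' e * q f = 0)
    (ck : ∀ v (h : G.IsRegular v), p v = ∑ e ∈ h.2.toFinset, q e * q' e) :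
    ∃ φ : LeavittPathAlgebra S G →ₙₐ[S] A, (∀ v, φ (vertex S G v) = p v) ∧
      (∀ e, φ (edge S G e) = q e) ∧ ∀ e, φ (ghost S G e) = q' e := by
  let F : LeavittPath.FreeAlg S V E →ₙₐ[S] A := freeLift fun
    | .vertex v => p v
    | .edge e => q e
    | .ghost e => q' e
  have Fv : ∀ v, F (LeavittPath.vtx S v) = p v := fun v => freeLift_gen _ _
  have Fe : ∀ e, F (LeavittPath.edg S e) = q e := fun e => freeLift_gen _ _
  have Fg : ∀ e, F (LeavittPath.gho S e) = q' e := fun e => freeLift_gen _ _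
  have hF : ∀ a b, LeavittPath.Rel S G a b → F a = F b := by
    intro a b h
    cases h with
    | vertex_mul_self v => rw [map_mul, Fv, vv]
    | vertex_mul_of_ne v w h => rw [map_mul, Fv, Fv, vw v w h, map_zero]
    | source_mul_edge e => rw [map_mul, Fv, Fe, se]
    | edge_mul_range e => rw [map_mul, Fv, Fe, er]
    | range_mul_ghost e => rw [map_mul, Fv, Fg, re]
    | ghost_mul_source e => rw [map_mul, Fv, Fg, es]
    | ghost_mul_edge_self e => rw [map_mul, Fv, Fg, Fe, ee]
    | ghost_mul_edge_of_ne e f h => rw [map_mul, Fg, Fe, ef e f h, map_zero]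
    | vertex_eq_sum v h =>
      rw [Fv, ck v h, map_sum]
      exact Finset.sum_congr rfl fun e _ => by rw [map_mul, Fe, Fg]
  have hker : ∀ a b, LeavittPath.con S G a b → F a = F b := fun a b h => by
    change RingConGen.Rel _ _ _ at h
    induction h with
    | of x y h =>
      obtain ⟨d, x, y, hr, rfl, rfl⟩ := h
      rw [map_smul, map_smul, hF x y hr]
    | refl x => rfl
    | symm _ ih => exact ih.symm
    | trans _ _ ih₁ ih₂ => exact ih₁.trans ih₂
    | add _ _ ih₁ ih₂ => rw [map_add, map_add, ih₁, ih₂]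
    | mul _ _ ih₁ ih₂ => rw [map_mul, map_mul, ih₁, ih₂]
  refine ⟨{ toFun := Quotient.lift F hker
            map_smul' := fun c => (mk_surjective S G).forall.2 fun a => map_smul F c a
            map_zero' := map_zero F
            map_add' := (mk_surjective S G).forall₂.2 fun a b => map_add F a b
            map_mul' := (mk_surjective S G).forall₂.2 fun a b => map_mul F a b }, Fv, Fe, Fg⟩

end lift

end LeavittPathAlgebra

/-! ### Branching systems and their function representations. -/

namespace DirGraph

variable {V E : Type*} (G : DirGraph V E)

/-- A set `X` of abstract boundary paths: every `x` has a source `base x`, and unless `base x` is not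
regular it splits uniquely as an edge followed by another boundary path. -/
structure BranchingSystem (X : Type*) where
  base : X → V
  step : X → Option (E × X)
  cons : E → X → X
  base_of_step {x y : X} {e : E} : step x = some (e, y) → G.source e = base x
  range_of_step {x y : X} {e : E} : step x = some (e, y) → G.range e = base y
  cons_of_step {x y : X} {e : E} : step x = some (e, y) → cons e y = x
  step_cons {e : E} {y : X} : G.range e = base y → step (cons e y) = some (e, y)
  exists_step {x : X} : G.IsRegular (base x) → ∃ e y, step x = some (e, y)

namespace BranchingSystem

variable {G} {X : Type*} (B : G.BranchingSystem X) (S M : Type*) [CommSemiring S]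
  [AddCommMonoid M] [Module S M]

open Classical in
/-- Projection onto the functions supported on boundary paths starting at `v`. -/
noncomputable def vertexEnd (v : V) : Module.End S (X → M) where
  toFun f x := if B.base x = v then f x else 0
  map_add' f g := by ext x; simp only [Pi.add_apply]; split_ifs <;> simp
  map_smul' c f := by ext x; simp only [Pi.smul_apply, RingHom.id_apply]; split_ifs <;> simp

-- Transport of `f` along `y ↦ e y`, extended by zero off the boundary paths beginning with `e`.
open Classical in
noncomputable def edgeEnd (e : E) : Module.End S (X → M) where
  toFun f x := (B.step x).elim 0 fun q => if q.1 = e then f q.2 else 0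
  map_add' f g := by
    ext x
    rcases h : B.step x with _ | q
    · simp [h]
    · simp only [h, Option.elim_some, Pi.add_apply]; split_ifs <;> simp
  map_smul' c f := by
    ext x
    rcases h : B.step x with _ | q
    · simp [h]
    · simp only [h, Option.elim_some, Pi.smul_apply, RingHom.id_apply]; split_ifs <;> simp

-- Pullback along `y ↦ e y`; a left inverse of `edgeEnd` on functions supported over the range of
-- `e`.
open Classical in
noncomputable def ghostEnd (e : E) : Module.End S (X → M) where
  toFun f y := if G.range e = B.base y then f (B.cons e y) else 0
  map_add' f g := by ext x; simp only [Pi.add_apply]; split_ifs <;> simp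
  map_smul' c f := by ext x; simp only [Pi.smul_apply, RingHom.id_apply]; split_ifs <;> simp

open Classical in
theorem vertexEnd_apply (v : V) (f : X → M) (x : X) :
    B.vertexEnd S M v f x = if B.base x = v then f x else 0 := rfl

theorem edgeEnd_of_none (e : E) (f : X → M) {x : X} (h : B.step x = none) :
    B.edgeEnd S M e f x = 0 := by
  simp [edgeEnd, h]

open Classical in
theorem edgeEnd_of_some (e : E) (f : X → M) {x y : X} {e' : E} (h : B.step x = some (e', y)) :
    B.edgeEnd S M e f x = if e' = e then f y else 0 := by
  simp [edgeEnd, h]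

open Classical in
theorem ghostEnd_apply (e : E) (f : X → M) (y : X) :
    B.ghostEnd S M e f y = if G.range e = B.base y then f (B.cons e y) else 0 := rfl

theorem base_cons {e : E} {y : X} (h : G.range e = B.base y) : B.base (B.cons e y) = G.source e :=
  (B.base_of_step (B.step_cons h)).symm

/-- The representation of the Leavitt path algebra on `M`-valued functions on a branching system. -/
theorem exists_rep : ∃ φ : LeavittPathAlgebra S G →ₙₐ[S] Module.End S (X → M),
    (∀ v, φ (LeavittPathAlgebra.vertex S G v) = B.vertexEnd S M v) ∧
    (∀ e, φ (LeavittPathAlgebra.edge S G e) = B.edgeEnd S M e) ∧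
    ∀ e, φ (LeavittPathAlgebra.ghost S G e) = B.ghostEnd S M e := by
  classical
  refine LeavittPathAlgebra.exists_hom _ _ _ (fun v => ?_) (fun v w h => ?_) (fun e => ?_)
    (fun e => ?_) (fun e => ?_) (fun e => ?_) (fun e => ?_) (fun e f h => ?_) (fun v h => ?_) <;>
    refine LinearMap.ext fun f => funext fun x => ?_
  · by_cases hx : B.base x = v <;> simp [vertexEnd_apply, hx]
  · by_cases hx : B.base x = v
    · have : B.base x ≠ w := hx ▸ h
      simp [vertexEnd_apply, this]
    · simp [vertexEnd_apply, hx]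
  · rw [Module.End.mul_apply, vertexEnd_apply]
    rcases hx : B.step x with _ | ⟨e', y⟩
    · simp [B.edgeEnd_of_none S M _ _ hx]
    · rw [B.edgeEnd_of_some S M _ _ hx]
      have := B.base_of_step hx
      split_ifs with h₁ h₂ <;> simp_all
  · rw [Module.End.mul_apply]
    rcases hx : B.step x with _ | ⟨e', y⟩
    · simp [B.edgeEnd_of_none S M _ _ hx]
    · rw [B.edgeEnd_of_some S M _ _ hx, B.edgeEnd_of_some S M _ _ hx, vertexEnd_apply]
      have := B.range_of_step hx
      split_ifs with h₁ h₂ <;> simp_all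
  · rw [Module.End.mul_apply, vertexEnd_apply, ghostEnd_apply]
    split_ifs <;> simp_all
  · rw [Module.End.mul_apply, ghostEnd_apply, ghostEnd_apply]
    split_ifs with h
    · rw [vertexEnd_apply, if_pos (B.base_cons h)]
    · rfl
  · rw [Module.End.mul_apply, ghostEnd_apply, vertexEnd_apply]
    by_cases h : G.range e = B.base x
    · rw [if_pos h, if_pos h.symm, B.edgeEnd_of_some S M _ _ (B.step_cons h), if_pos rfl]
    · rw [if_neg h, if_neg (Ne.symm h)]
  · rw [Module.End.mul_apply, ghostEnd_apply]
    by_cases h' : G.range e = B.base x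
    · rw [if_pos h', B.edgeEnd_of_some S M _ _ (B.step_cons h'), if_neg h]
      rfl
    · rw [if_neg h']
      rfl
  · rw [LinearMap.sum_apply, Finset.sum_apply, vertexEnd_apply]
    rcases hx : B.step x with _ | ⟨e', y⟩
    · have hv : B.base x ≠ v := fun hv => by
        obtain ⟨e, y, h⟩ := B.exists_step (hv ▸ h)
        simp [hx] at h
      rw [if_neg hv]
      exact (Finset.sum_eq_zero fun e _ => B.edgeEnd_of_none S M _ _ hx).symm
    -- Only the summand of the first edge of `x` survives, which is the relation `v = ∑ e e*` at
    -- `x`.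
    · have key : ∀ e, (B.edgeEnd S M e * B.ghostEnd S M e) f x = if e' = e then f x else 0 := by
        intro e
        rw [Module.End.mul_apply, B.edgeEnd_of_some S M _ _ hx, ghostEnd_apply]
        split_ifs with h₁ h₂
        · rw [← h₁, B.cons_of_step hx]
        · exact absurd (h₁ ▸ B.range_of_step hx) h₂
        · rfl
      simp only [key, Finset.sum_ite_eq, Set.Finite.mem_toFinset, Set.mem_ofPred_eq,
        B.base_of_step hx]

end BranchingSystem

/-- On a row-finite graph, the complement of a hereditary saturated set carries a branching system
with infinite fibres, in which the edges that are alone at their source shift the fibre by `k`. -/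
theorem exists_branchingSystem (hG : G.RowFinite) {H : Set V} (hH : G.IsHereditary H)
    (hH' : G.IsSaturated H) (k : ℤ) :
    ∃ B : G.BranchingSystem ({v // v ∉ H} × ℤ), (∀ x, B.base x = x.1) ∧
      ∀ e (hs : G.source e ∉ H) (hr : G.range e ∉ H) (n : ℤ),
        (∀ f, G.source f = G.source e → f = e) →
        B.step (⟨_, hs⟩, n) = some (e, (⟨_, hr⟩, n + k)) := by
  classical
  let A : V → Type _ := fun v => {e // G.source e = v ∧ G.range e ∉ H}
  have hA : ∀ v, Finite (A v) := fun v =>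
    ((hG v).subset fun e he => he.1 : {e | G.source e = v ∧ G.range e ∉ H}.Finite)
  -- `θ` sends a fibre index to the pair (first edge, fibre index of the tail). When `v` emits a
  -- single edge the shift by `k` is already a bijection; otherwise any bijection of countably
  -- infinite sets will do.
  have hθ : ∀ v, Nonempty (A v) → ∃ θ : ℤ ≃ A v × ℤ, ∀ e : A v,
      (∀ f, G.source f = v → f = e) → ∀ n, θ n = (e, n + k) := by
    intro v hv
    by_cases h : ∃ e : A v, ∀ f, G.source f = v → f = e
    · obtain ⟨e, he⟩ := h
      refine ⟨⟨fun n => (e, n + k), fun q => q.2 - k, fun n => by simp, fun q => ?_⟩,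
        fun e' he' n => ?_⟩
      · have : q.1 = e := Subtype.ext (he _ q.1.2.1)
        simp [← this]
      · have : e = e' := Subtype.ext (he' _ e.2.1)
        simp [this]
    · push Not at h
      obtain ⟨θ⟩ : Nonempty (ℤ ≃ A v × ℤ) := nonempty_equiv_of_countable
      refine ⟨θ, fun e he => ?_⟩
      obtain ⟨f, hf, hf'⟩ := h e
      exact absurd (he f hf) hf'
  choose θ hθ using hθ
  -- Saturation is what lets a regular vertex outside `H` continue outside `H`.
  have hreg : ∀ v, G.IsRegular v → v ∉ H → Nonempty (A v) := by
    intro v hv hvH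
    by_contra hne
    refine hvH (hH' v hv fun e he => by_contra fun her => hne ⟨⟨e, he, her⟩⟩)
  let step : {v // v ∉ H} × ℤ → Option (E × ({v // v ∉ H} × ℤ)) := fun x =>
    if h : Nonempty (A x.1) then
      some ((θ x.1 h x.2).1.1, (⟨_, (θ x.1 h x.2).1.2.2⟩, (θ x.1 h x.2).2))
    else none
  -- Heredity puts the source of `e` outside `H` when its range is; the value `y` in the other case
  -- is junk.
  let cons : E → {v // v ∉ H} × ℤ → {v // v ∉ H} × ℤ := fun e y =>
    if h : G.range e ∉ H then
      (⟨G.source e, fun hs => h (hH e hs)⟩,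
        (θ (G.source e) ⟨⟨e, rfl, h⟩⟩).symm (⟨e, rfl, h⟩, y.2))
    else y
  have step_eq : ∀ {x y e}, step x = some (e, y) → ∃ h : Nonempty (A x.1),
      e = (θ x.1 h x.2).1.1 ∧ G.range e = y.1 ∧ y.2 = (θ x.1 h x.2).2 := by
    intro x y e hxy
    by_cases h : Nonempty (A x.1)
    · simp only [step, dif_pos h, Option.some.injEq, Prod.mk.injEq] at hxy
      obtain ⟨h₁, rfl⟩ := hxy
      exact ⟨h, h₁.symm, by rw [← h₁], rfl⟩
    · simp [step, dif_neg h] at hxy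
  refine ⟨{ base := fun x => x.1
            step := step
            cons := cons
            base_of_step := ?_
            range_of_step := fun h => (step_eq h).2.2.1
            cons_of_step := ?_
            step_cons := ?_
            exists_step := ?_ }, fun _ => rfl, ?_⟩
  · intro x y e h
    obtain ⟨hne, rfl, -⟩ := step_eq h
    exact (θ x.1 hne x.2).1.2.1
  · rintro ⟨⟨v, hv⟩, n⟩ ⟨w, m⟩ e hxy
    obtain ⟨h, he, hr, hm⟩ := step_eq hxy
    have hs : G.source e = v := by
      rw [he]
      exact (θ v h n).1.2.1
    subst hs
    have hr' : G.range e ∉ H := hr ▸ w.2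
    simp only [cons, dif_pos hr', Prod.mk.injEq, true_and]
    rw [Equiv.symm_apply_eq]
    exact Prod.ext (Subtype.ext he) hm
  · rintro e ⟨⟨w, hw⟩, m⟩ h
    obtain rfl : G.range e = w := h
    have hne : Nonempty (A (G.source e)) := ⟨⟨e, rfl, hw⟩⟩
    simp only [cons, dif_pos hw, step, dif_pos hne, Equiv.apply_symm_apply]
  · rintro x hx
    have h := hreg x.1 hx x.1.2
    exact ⟨_, _, dif_pos h⟩
  · intro e hs hr n he
    have hne : Nonempty (A (G.source e)) := ⟨⟨e, rfl, hr⟩⟩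
    simp only [step, dif_pos hne, hθ _ hne ⟨e, rfl, hr⟩ he]

end DirGraph

/-! ### Paths as lists of edges with endpoints. -/

namespace DirGraph

variable {V E : Type*} (G : DirGraph V E)

/-- `p` is a path from `u` to `w`. -/
def IsPath : V → List E → V → Prop
  | u, [], w => u = w
  | u, e :: p, w => G.source e = u ∧ IsPath (G.range e) p w

variable {G}

theorem IsPath.append {u v w : V} {p q : List E} (hp : G.IsPath u p v) (hq : G.IsPath v q w) :
    G.IsPath u (p ++ q) w := by
  induction p generalizing u with
  | nil => exact (show u = v from hp) ▸ hq
  | cons e p ih => exact ⟨hp.1, ih hp.2⟩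

theorem isPath_append {u w : V} {p q : List E} :
    G.IsPath u (p ++ q) w ↔ ∃ v, G.IsPath u p v ∧ G.IsPath v q w := by
  refine ⟨fun h => ?_, fun ⟨v, hp, hq⟩ => hp.append hq⟩
  induction p generalizing u with
  | nil => exact ⟨u, rfl, h⟩
  | cons e p ih =>
    obtain ⟨v, h₁, h₂⟩ := ih h.2
    exact ⟨v, ⟨h.1, h₁⟩, h₂⟩

theorem isPath_of_isChain {e : E} {p : List E}
    (h : (e :: p).IsChain fun e f => G.range e = G.source f) :
    G.IsPath (G.source e) (e :: p) (G.range ((e :: p).getLast (List.cons_ne_nil e p))) := by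
  induction p generalizing e with
  | nil => exact ⟨rfl, rfl⟩
  | cons f p ih =>
    rw [List.isChain_cons_cons] at h
    refine ⟨rfl, ?_⟩
    rw [h.1, List.getLast_cons (List.cons_ne_nil f p)]
    exact ih h.2

theorem IsPath.isChain {u w : V} {e : E} {p : List E} (h : G.IsPath u (e :: p) w) :
    ((e :: p).IsChain fun e f => G.range e = G.source f) ∧
      G.range ((e :: p).getLast (List.cons_ne_nil e p)) = w := by
  induction p generalizing e u with
  | nil => exact ⟨List.isChain_singleton _, h.2⟩
  | cons f p ih =>
    obtain ⟨h₁, h₂⟩ := ih h.2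
    rw [List.isChain_cons_cons, List.getLast_cons (List.cons_ne_nil f p)]
    exact ⟨⟨h.2.1.symm, h₁⟩, h₂⟩

end DirGraph

/-! ### Necessity of the three conditions. -/

namespace LeavittPathAlgebra

variable {S V E : Type*} [CommSemiring S] {G : DirGraph V E}

/-- Left multiplication by the product of the edges of `p`. -/
noncomputable def pathMul (p : List E) (x : LeavittPathAlgebra S G) : LeavittPathAlgebra S G :=
  p.foldr (fun e y => edge S G e * y) x

@[simp] theorem pathMul_nil (x : LeavittPathAlgebra S G) : pathMul [] x = x := rfl

@[simp] theorem pathMul_cons (e : E) (p : List E) (x : LeavittPathAlgebra S G) :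
    pathMul (e :: p) x = edge S G e * pathMul p x := rfl

open Classical in
theorem exists_rep (M : Type*) [AddCommMonoid M] [Module S M] (hG : G.RowFinite) {H : Set V}
    (hH : G.IsHereditary H) (hH' : G.IsSaturated H) (k : ℤ) :
    ∃ φ : LeavittPathAlgebra S G →ₙₐ[S] Module.End S ({v // v ∉ H} × ℤ → M),
      (∀ v f x, φ (vertex S G v) f x = if x.1 = v then f x else 0) ∧
      (∀ e f x, (x.1 : V) ≠ G.source e → φ (edge S G e) f x = 0) ∧
      ∀ e f (hs : G.source e ∉ H) (hr : G.range e ∉ H) (n : ℤ),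
        (∀ f, G.source f = G.source e → f = e) →
        φ (edge S G e) f (⟨_, hs⟩, n) = f (⟨_, hr⟩, n + k) := by
  obtain ⟨B, hB, hB'⟩ := G.exists_branchingSystem hG hH hH' k
  obtain ⟨φ, h₁, h₂, -⟩ := B.exists_rep S M
  refine ⟨φ, fun v f x => ?_, fun e f x hx => ?_, fun e f hs hr n he => ?_⟩
  · rw [h₁, B.vertexEnd_apply, hB]
  · rw [h₂]
    rcases h : B.step x with _ | ⟨e', y⟩
    · exact B.edgeEnd_of_none S M _ _ h
    · rw [B.edgeEnd_of_some S M _ _ h, if_neg]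
      rintro rfl
      exact hx ((hB x).symm.trans (B.base_of_step h).symm)
  · rw [h₂, B.edgeEnd_of_some S M _ _ (hB' e hs hr n he), if_pos rfl]

theorem isHereditary_empty : G.IsHereditary ∅ := fun _ h => h

theorem isSaturated_empty : G.IsSaturated ∅ := fun _ ⟨⟨e, he⟩, _⟩ h => (h e he).elim

/-- The coefficient `c` is recovered by letting `c v` act on the constant function `1` and
evaluating over `v`. -/
theorem smul_vertex_injective (hG : G.RowFinite) (v : V) :
    Function.Injective fun c : S => c • vertex S G v := by
  classical
  intro a b hab
  obtain ⟨φ, hφ, -⟩ := exists_rep (S := S) S hG isHereditary_empty isSaturated_empty 0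
  have := congrFun (LinearMap.congr_fun (congrArg φ hab) 1) (⟨v, Set.notMem_empty v⟩, 0)
  simpa [hφ] using this

variable [Nonempty V]

/-- Let the algebra act on functions with values in `S ⧸ ρ`. If the kernel is trivial, `ρ`-related
scalars give equal multiples of `v`, so they are equal; if it is universal, `v` acts as zero and `1
= 0` in `S ⧸ ρ`. -/
theorem isCongruenceSimple_coeff (hG : G.RowFinite)
    (h : IsCongruenceSimple (LeavittPathAlgebra S G)) : IsCongruenceSimple S := by
  classical
  obtain ⟨hnt, h⟩ := isCongruenceSimple_iff.1 h
  obtain ⟨v⟩ := ‹Nonempty V›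
  have hS : Nontrivial S := by
    by_contra hS
    rw [not_nontrivial_iff_subsingleton] at hS
    exact not_subsingleton _ (Module.subsingleton S (LeavittPathAlgebra S G))
  refine isCongruenceSimple_iff.2 ⟨hS, fun ρ => ?_⟩
  obtain ⟨φ, hφ, -⟩ :=
    exists_rep (S := S) ρ.Quotient hG isHereditary_empty isSaturated_empty 0
  rcases h (RingCon.comap ⊥ φ) with h | h
  · refine Or.inl fun a b hab => smul_vertex_injective hG v (h _ _ ?_)
    have hab' : (a : ρ.Quotient) = b := (RingCon.eq ρ).2 hab
    change φ (a • vertex S G v) = φ (b • vertex S G v)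
    rw [map_smul, map_smul]
    refine LinearMap.ext fun f => funext fun x => ?_
    have key : ∀ q : ρ.Quotient, a • q = b • q := fun q => by
      have : ∀ c : S, c • q = (c : ρ.Quotient) * q := fun c => by
        rw [Algebra.smul_def]
        rfl
      rw [this, this, hab']
    exact key _
  · refine Or.inr fun x y => ?_
    have := congrFun (LinearMap.congr_fun (show φ (vertex S G v) = φ 0 from h _ _) 1)
      (⟨v, Set.notMem_empty v⟩, 0)
    have h10 : ((1 : S) : ρ.Quotient) = (0 : S) := by simpa [hφ] using this
    have := RingCon.eq_top_of_one_zero ((RingCon.eq ρ).1 h10)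
    subst this
    trivial

/-- In the representation supported outside `H`, vertices in `H` act as zero and those outside do
not, so for proper nonempty `H` the kernel is neither trivial nor universal. -/
theorem eq_empty_or_univ_of_isCongruenceSimple (hG : G.RowFinite)
    (h : IsCongruenceSimple (LeavittPathAlgebra S G)) {H : Set V} (hH : G.IsHereditary H)
    (hH' : G.IsSaturated H) : H = ∅ ∨ H = Set.univ := by
  classical
  have := (isCongruenceSimple_coeff hG h).1
  by_contra! hne
  obtain ⟨v, hv⟩ := hne.1
  obtain ⟨w, hw⟩ := (Set.ne_univ_iff_exists_notMem H).1 hne.2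
  obtain ⟨φ, hφ, -⟩ := exists_rep (S := S) S hG hH hH' 0
  rcases (isCongruenceSimple_iff.1 h).2 (RingCon.comap ⊥ φ) with h | h
  · have hv0 : vertex S G v = 0 := h _ _ <| by
      change φ (vertex S G v) = φ 0
      refine LinearMap.ext fun f => funext fun x => ?_
      have : (x.1 : V) ≠ v := fun h => x.1.2 (h ▸ hv)
      simp [hφ, this]
    exact one_ne_zero (smul_vertex_injective (S := S) hG v (a₁ := 1) (a₂ := 0) (by simp [hv0]))
  · have := congrFun (LinearMap.congr_fun (show φ (vertex S G w) = φ 0 from h _ _) 1)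
      (⟨w, hw⟩, 0)
    simp [hφ] at this

/-- Without an exit, every edge of the cycle is alone at its source, so the cycle acts over `u` as
translation by `k` times its length. The kernel for `k = 0` identifies the cycle with `u`, but the
representation for `k = 1` shows that they differ. -/
theorem exists_isExit_of_isCongruenceSimple (hG : G.RowFinite)
    (h : IsCongruenceSimple (LeavittPathAlgebra S G)) {p : List E} (hp : G.IsCycle p) :
    ∃ f, G.IsExit f p := by
  classical
  have := (isCongruenceSimple_coeff hG h).1
  by_contra hexit
  have hp' : ∀ e ∈ p, ∀ f, G.source f = G.source e → f = e := fun e he f hf =>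
    by_contra fun hne => hexit ⟨f, e, he, hf, hne⟩
  obtain ⟨hchain, ⟨hne, hclosed⟩, -⟩ := hp
  obtain ⟨u, hpath⟩ : ∃ u, G.IsPath u p u := by
    obtain ⟨e, p, rfl⟩ := List.exists_cons_of_ne_nil hne
    refine ⟨G.source e, ?_⟩
    have := DirGraph.isPath_of_isChain hchain
    rwa [hclosed] at this
  have rep : ∀ k : ℤ, ∃ φ : LeavittPathAlgebra S G →ₙₐ[S]
      Module.End S ({v // v ∉ (∅ : Set V)} × ℤ → S),
      (∀ v f x, φ (vertex S G v) f x = if x.1 = v then f x else 0) ∧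
      ∀ f x, φ (pathMul p (vertex S G u)) f x =
        if x.1 = u then f (x.1, x.2 + k * p.length) else 0 := by
    intro k
    obtain ⟨φ, h₁, h₂, h₃⟩ := exists_rep (S := S) S hG isHereditary_empty isSaturated_empty k
    refine ⟨φ, h₁, ?_⟩
    -- Stated for paths that need not be closed, since tails of the cycle are not.
    have key : ∀ (q : List E) (v w : V), (∀ e ∈ q, ∀ f, G.source f = G.source e → f = e) →
        G.IsPath v q w → ∀ f x, φ (pathMul q (vertex S G w)) f x =
        if x.1 = v then f (⟨w, Set.notMem_empty w⟩, x.2 + k * q.length) else 0 := by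
      intro q
      induction q with
      | nil =>
        rintro v w - hvw f ⟨⟨x, hx⟩, n⟩
        obtain rfl : v = w := hvw
        rw [pathMul_nil, h₁]
        by_cases h : x = v
        · subst h; simp
        · simp [h]
      | cons e q ih =>
        rintro v w hq ⟨rfl, hvw⟩ f ⟨⟨x, hx⟩, n⟩
        rw [pathMul_cons, map_mul, Module.End.mul_apply]
        by_cases h : x = G.source e
        · subst h
          rw [h₃ _ _ hx (Set.notMem_empty _) n (hq e List.mem_cons_self),
            ih _ w (fun e he => hq e (List.mem_cons_of_mem _ he)) hvw, if_pos rfl, if_pos rfl]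
          congr 2
          push_cast [List.length_cons]
          ring
        · rw [h₂ _ _ _ h, if_neg h]
    intro f x
    rw [key p u u hp' hpath f x]
    split_ifs with hx
    · rw [show x.1 = ⟨u, Set.notMem_empty u⟩ from Subtype.ext hx]
    · rfl
  obtain ⟨φ₀, hv₀, hp₀⟩ := rep 0
  obtain ⟨φ₁, hv₁, hp₁⟩ := rep 1
  have hu : u ∉ (∅ : Set V) := Set.notMem_empty u
  rcases (isCongruenceSimple_iff.1 h).2 (RingCon.comap ⊥ φ₀) with h | h
  · have heq : pathMul p (vertex S G u) = vertex S G u := h _ _ <| by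
      change φ₀ _ = φ₀ _
      refine LinearMap.ext fun f => funext fun x => ?_
      simp [hv₀, hp₀]
    -- The indicator of `(u, 0)` has value `1` there under `u`, but `0` under the cycle, which reads
    -- it at `(u, p.length)` with `p` nonempty.
    have := congrFun (LinearMap.congr_fun (congrArg φ₁ heq) (Pi.single (⟨u, hu⟩, 0) 1))
      (⟨u, hu⟩, 0)
    simp [hv₁, hp₁, hne] at this
  · have := congrFun (LinearMap.congr_fun (show φ₀ (vertex S G u) = φ₀ 0 from h _ _) 1)
      (⟨u, hu⟩, 0)
    simp [hv₀] at this

end LeavittPathAlgebra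

/-! ### Exits and incomparable extensions of paths. -/

namespace DirGraph

variable {V E : Type*} {G : DirGraph V E}

theorem IsPath.unique {u w w' : V} {p : List E} (h : G.IsPath u p w) (h' : G.IsPath u p w') :
    w = w' := by
  induction p generalizing u with
  | nil => exact (show u = w from h).symm.trans h'
  | cons e p ih => exact ih h.2 h'.2

theorem exists_eq_append_of_not_nodup_map {α β : Type*} (f : α → β) {l : List α}
    (h : ¬ (l.map f).Nodup) : ∃ a x b y c, l = a ++ (x :: b ++ y :: c) ∧ f x = f y := by
  induction l with
  | nil => simp at h
  | cons x l ih =>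
    by_cases hl : (l.map f).Nodup
    · have : f x ∈ l.map f := by
        by_contra hx
        exact h (List.nodup_cons.2 ⟨hx, hl⟩)
      obtain ⟨y, hy, hxy⟩ := List.mem_map.1 this
      obtain ⟨b, c, rfl⟩ := List.append_of_mem hy
      exact ⟨[], x, b, y, c, rfl, hxy.symm⟩
    · obtain ⟨a, x', b, y, c, rfl, hxy⟩ := ih hl
      exact ⟨x :: a, x', b, y, c, rfl, hxy⟩

/-- A closed path that repeats a source contains a strictly shorter closed path, and an exit of the
shorter one is an exit of the whole. Strong induction on length ends at genuine cycles. -/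
theorem IsPath.exists_isExit (hL : ∀ p, G.IsCycle p → ∃ f, G.IsExit f p) {w : V} {p : List E}
    (hp : G.IsPath w p w) (hne : p ≠ []) : ∃ f, G.IsExit f p := by
  induction hn : p.length using Nat.strong_induction_on generalizing w p with
  | _ n ih =>
  obtain ⟨e, p, rfl⟩ := List.exists_cons_of_ne_nil hne
  by_cases hnd : ((e :: p).map G.source).Nodup
  · obtain ⟨h₁, h₂⟩ := hp.isChain
    exact hL _ ⟨h₁, ⟨hne, h₂.trans hp.1.symm⟩, hnd⟩
  · obtain ⟨a, x, b, y, c, heq, hxy⟩ := exists_eq_append_of_not_nodup_map G.source hnd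
    rw [heq] at hp hn ⊢
    obtain ⟨v, -, hp⟩ := isPath_append.1 hp
    obtain ⟨v', hb, hc⟩ := isPath_append.1 hp
    obtain rfl : v = v' := by rw [← hb.1, hxy, hc.1]
    obtain ⟨f, e, he, hf⟩ := ih _ (by simp at hn ⊢; omega) hb (List.cons_ne_nil x b) rfl
    exact ⟨f, e, by simp at he ⊢; tauto, hf⟩

theorem isPath_flatten_replicate {w : V} {p : List E} (hp : G.IsPath w p w) (k : ℕ) :
    G.IsPath w (List.replicate k p).flatten w := by
  induction k with
  | zero => rfl
  | succ k ih => exact hp.append ih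

theorem flatten_replicate_append {α : Type*} (p : List α) (k : ℕ) :
    (List.replicate k p).flatten ++ p = p ++ (List.replicate k p).flatten := by
  induction k with
  | zero => simp
  | succ k ih => rw [List.replicate_succ, List.flatten_cons, List.append_assoc, ih]

/-- Iterating the hypothesis makes `m` a prefix of `p ^ k m` for every `k`; for `k = m.length` the
power `p ^ k` is already at least as long as `m`. -/
theorem isPrefix_of_isPrefix_append {α : Type*} {p m : List α} (hp : p ≠ []) (h : m <+: p ++ m) :
    m <+: (List.replicate m.length p).flatten := by
  have key : ∀ k, m <+: (List.replicate k p).flatten ++ m := fun k => by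
    induction k with
    | zero => exact List.prefix_rfl
    | succ k ih =>
      rw [List.replicate_succ, List.flatten_cons, List.append_assoc]
      exact h.trans ((List.prefix_append_right_inj p).2 ih)
  refine List.prefix_of_prefix_length_le (key m.length) (List.prefix_append _ _) ?_
  have : 0 < p.length := List.length_pos_iff.2 hp
  simp only [List.length_flatten, List.map_replicate, List.sum_replicate, smul_eq_mul]
  exact Nat.le_mul_of_pos_right _ this

/-- If `m` follows the infinite word `p p p ⋯`, continue along it and leave by an exit. With `p = a
e b` and exit `f` at `e`, extend `m` to `p ^ k a f`; then `p p ^ k a f = p ^ k a e b a f` has `e`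
where the extension has `f`. -/
theorem exists_not_isPrefix (hL : ∀ p, G.IsCycle p → ∃ f, G.IsExit f p) {w v : V} {p m : List E}
    (hp : G.IsPath w p w) (hne : p ≠ []) (hm : G.IsPath w m v) :
    ∃ n v', G.IsPath v n v' ∧ ¬ (m ++ n) <+: (p ++ (m ++ n)) := by
  by_cases h : m <+: p ++ m
  · obtain ⟨t, ht⟩ := isPrefix_of_isPrefix_append hne h
    have hpath := isPath_flatten_replicate hp m.length
    obtain ⟨f, e, he, hfe, hfe'⟩ := hp.exists_isExit hL hne
    obtain ⟨a, b, rfl⟩ := List.append_of_mem he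
    obtain ⟨x, ha, hb⟩ := isPath_append.1 hp
    rw [← ht] at hpath
    obtain ⟨v', hm', ht'⟩ := isPath_append.1 hpath
    obtain rfl := hm.unique hm'
    refine ⟨t ++ (a ++ [f]), G.range f, ht'.append (ha.append ⟨hfe.trans hb.1, rfl⟩), fun hpre => ?_⟩
    rw [← List.append_assoc m, ht, ← List.append_assoc (a ++ e :: b), ← flatten_replicate_append,
      List.append_assoc, List.prefix_append_right_inj, List.append_assoc,
      List.prefix_append_right_inj, List.cons_append, List.cons_prefix_cons] at hpre
    exact hfe' hpre.1
  · exact ⟨[], v, rfl, by simpa using h⟩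

/-- One of the lists is a prefix of the other. -/
def Comparable {α : Type*} (p q : List α) : Prop := p <+: q ∨ q <+: p

theorem Comparable.of_append {α : Type*} {p q r s : List α} (h : Comparable (p ++ r) (q ++ s)) :
    Comparable p q := by
  rcases h with h | h
  · exact List.prefix_or_prefix_of_prefix ((List.prefix_append _ _).trans h)
      (List.prefix_append _ _)
  · exact List.prefix_or_prefix_of_prefix (List.prefix_append _ _)
      ((List.prefix_append _ _).trans h)

/-- The only obstruction is `q = p c` up to symmetry, with `c` a nonempty closed path at `w`.
Cancelling `p` reduces the claim to `exists_not_isPrefix` for `c`. -/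
theorem exists_not_comparable (hL : ∀ p, G.IsCycle p → ∃ f, G.IsExit f p) {u w v : V}
    {p q m : List E} (hp : G.IsPath u p w) (hq : G.IsPath u q w) (hne : p ≠ q)
    (hm : G.IsPath w m v) :
    ∃ n v', G.IsPath v n v' ∧ ¬ Comparable (p ++ (m ++ n)) (q ++ (m ++ n)) := by
  wlog hlen : p.length ≤ q.length generalizing p q
  · obtain ⟨n, v', hn, h⟩ := this hq hp hne.symm (le_of_not_ge hlen)
    exact ⟨n, v', hn, fun hc => h hc.symm⟩
  by_cases h : p <+: q
  · obtain ⟨c, rfl⟩ := h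
    have hc : c ≠ [] := by
      rintro rfl
      simp at hne
    obtain ⟨w', hp', hcp⟩ := isPath_append.1 hq
    obtain rfl := hp.unique hp'
    obtain ⟨n, v', hn, h⟩ := exists_not_isPrefix hL hcp hc hm
    refine ⟨n, v', hn, ?_⟩
    rintro (h' | h')
    · rw [List.append_assoc, List.prefix_append_right_inj] at h'
      exact h h'
    · have := h'.length_le
      have := List.length_pos_iff.2 hc
      simp only [List.length_append] at *
      omega
  · refine ⟨[], v, rfl, fun hc => h ?_⟩
    rcases hc.of_append with h | h
    · exact h
    · exact (h.eq_of_length_le hlen) ▸ List.prefix_rfl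

/-- Competitors are handled one at a time: lengthening the common tail never destroys
incomparability already achieved. -/
theorem exists_forall_not_comparable (hL : ∀ p, G.IsCycle p → ∃ f, G.IsExit f p) {u w : V}
    {p : List E} (hp : G.IsPath u p w) (T : Finset (List E))
    (hT : ∀ q ∈ T, q ≠ p ∧ G.IsPath u q w) :
    ∃ m v, G.IsPath w m v ∧ ∀ q ∈ T, ¬ Comparable (p ++ m) (q ++ m) := by
  classical
  induction T using Finset.induction_on with
  | empty => exact ⟨[], w, rfl, by simp⟩
  | insert a T _ ih =>
    obtain ⟨m, v, hm, h⟩ := ih fun q hq => hT q (Finset.mem_insert_of_mem hq)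
    obtain ⟨ha, ha'⟩ := hT a (Finset.mem_insert_self a T)
    obtain ⟨n, v', hn, h'⟩ := exists_not_comparable hL hp ha' ha.symm hm
    refine ⟨m ++ n, v', hm.append hn, fun q hq => ?_⟩
    rcases Finset.mem_insert.1 hq with rfl | hq
    · exact h'
    · intro hc
      rw [← List.append_assoc, ← List.append_assoc] at hc
      exact h q hq hc.of_append

end DirGraph

/-! ### Products of paths and ghost paths. -/

namespace LeavittPathAlgebra

open DirGraph

variable {S V E : Type*} [CommSemiring S] {G : DirGraph V E}

theorem pathMul_append (p q : List E) (x : LeavittPathAlgebra S G) :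
    pathMul (p ++ q) x = pathMul p (pathMul q x) := List.foldr_append

theorem pathMul_mul (p : List E) (x y : LeavittPathAlgebra S G) :
    pathMul p x * y = pathMul p (x * y) := by
  induction p with
  | nil => rfl
  | cons e p ih => rw [pathMul_cons, pathMul_cons, mul_assoc, ih]

@[simp] theorem pathMul_zero (p : List E) : pathMul p (0 : LeavittPathAlgebra S G) = 0 := by
  induction p with
  | nil => rfl
  | cons e p ih => rw [pathMul_cons, ih, mul_zero]

theorem vertex_mul_pathMul {u w : V} {p : List E} (hp : G.IsPath u p w) :
    vertex S G u * pathMul p (vertex S G w) = pathMul p (vertex S G w) := by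
  cases p with
  | nil =>
    obtain rfl : u = w := hp
    simp
  | cons e p =>
    obtain ⟨rfl, -⟩ := hp
    rw [pathMul_cons, ← mul_assoc, source_mul_edge]

theorem vertex_mul_pathMul_of_ne {u v w : V} {p : List E} (hp : G.IsPath u p w) (h : v ≠ u) :
    vertex S G v * pathMul p (vertex S G w) = 0 := by
  rw [← vertex_mul_pathMul hp, ← mul_assoc, vertex_mul_of_ne h, zero_mul]

variable (S G) in
/-- Left multiplication by the ghost path of `p`. -/
noncomputable def ghostMul : List E → LeavittPathAlgebra S G →ₗ[S] LeavittPathAlgebra S G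
  | [] => LinearMap.id
  | e :: p => ghostMul p ∘ₗ LinearMap.mulLeft S (ghost S G e)

theorem ghostMul_cons (e : E) (p : List E) (x : LeavittPathAlgebra S G) :
    ghostMul S G (e :: p) x = ghostMul S G p (ghost S G e * x) := rfl

theorem ghostMul_pathMul_self {u w : V} {p : List E} (hp : G.IsPath u p w) :
    ghostMul S G p (pathMul p (vertex S G w)) = vertex S G w := by
  induction p generalizing u with
  | nil => rfl
  | cons e p ih =>
    rw [ghostMul_cons, pathMul_cons, ← mul_assoc, ghost_mul_edge_self, vertex_mul_pathMul hp.2,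
      ih hp.2]

theorem ghostMul_pathMul_of_not_comparable {u w : V} {p q : List E} (hq : G.IsPath u q w)
    (h : ¬ Comparable p q) : ghostMul S G p (pathMul q (vertex S G w)) = 0 := by
  induction p generalizing u q with
  | nil => exact absurd (Or.inl List.nil_prefix) h
  | cons e p ih =>
    cases q with
    | nil => exact absurd (Or.inr List.nil_prefix) h
    | cons f q =>
      rw [ghostMul_cons, pathMul_cons, ← mul_assoc]
      by_cases hef : e = f
      · subst hef
        rw [ghost_mul_edge_self, vertex_mul_pathMul hq.2]
        refine ih hq.2 fun hc => h ?_
        simpa [Comparable, List.cons_prefix_cons] using hc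
      · rw [ghost_mul_edge_of_ne hef, zero_mul, map_zero]

theorem rel_ghostMul (ρ : RingCon (LeavittPathAlgebra S G)) (p : List E)
    {x y : LeavittPathAlgebra S G} (h : ρ x y) : ρ (ghostMul S G p x) (ghostMul S G p y) := by
  induction p generalizing x y with
  | nil => exact h
  | cons e p ih => exact ih (ρ.mul (ρ.refl _) h)

/-! ### Filtration by ghost length, and local units. -/

variable (S G) in
/-- The span of the products `p q*` of paths with `q` of length at most `n`. -/
noncomputable def ghostFiltration : ℕ → Submodule S (LeavittPathAlgebra S G)
  | 0 => Submodule.span S {x | ∃ u p w, G.IsPath u p w ∧ x = pathMul p (vertex S G w)}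
  | n + 1 => ghostFiltration n ⊔
      Submodule.span S {x | ∃ y ∈ ghostFiltration n, ∃ e, x = y * ghost S G e}

theorem ghostFiltration_mono : Monotone (ghostFiltration S G) :=
  monotone_nat_of_le_succ fun _ => le_sup_left

theorem ghostFiltration_le_succ (n : ℕ) : ghostFiltration S G n ≤ ghostFiltration S G (n + 1) :=
  le_sup_left

theorem pathMul_mem {u w : V} {p : List E} (h : G.IsPath u p w) :
    pathMul p (vertex S G w) ∈ ghostFiltration S G 0 :=
  Submodule.subset_span ⟨u, p, w, h, rfl⟩

theorem mul_ghost_mem {n : ℕ} {x : LeavittPathAlgebra S G} (hx : x ∈ ghostFiltration S G n)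
    (e : E) : x * ghost S G e ∈ ghostFiltration S G (n + 1) :=
  Submodule.mem_sup_right (Submodule.subset_span ⟨x, hx, e, rfl⟩)

theorem ghostFiltration_zero_induction {C : LeavittPathAlgebra S G → Prop} (zero : C 0)
    (add : ∀ x y, C x → C y → C (x + y)) (smul : ∀ (c : S) x, C x → C (c • x))
    (path : ∀ u p w, G.IsPath u p w → C (pathMul p (vertex S G w)))
    {x : LeavittPathAlgebra S G} (hx : x ∈ ghostFiltration S G 0) : C x := by
  refine Submodule.span_induction ?_ zero (fun x y _ _ => add x y) (fun c x _ => smul c x) hx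
  rintro _ ⟨u, p, w, hp, rfl⟩
  exact path u p w hp

theorem ghostFiltration_succ_induction {n : ℕ} {C : LeavittPathAlgebra S G → Prop}
    (add : ∀ x y, C x → C y → C (x + y)) (smul : ∀ (c : S) x, C x → C (c • x))
    (base : ∀ x ∈ ghostFiltration S G n, C x)
    (ghost' : ∀ x ∈ ghostFiltration S G n, ∀ e, C (x * ghost S G e))
    {x : LeavittPathAlgebra S G} (hx : x ∈ ghostFiltration S G (n + 1)) : C x := by
  obtain ⟨y, hy, z, hz, rfl⟩ := Submodule.mem_sup.1 hx
  refine add _ _ (base y hy) (Submodule.span_induction ?_ (base 0 (zero_mem _))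
    (fun x y _ _ => add x y) (fun c x _ => smul c x) hz)
  rintro _ ⟨x, hx, e, rfl⟩
  exact ghost' x hx e

theorem pathMul_vertex_mul_edge_mem {u w : V} {p : List E} (hp : G.IsPath u p w) (e : E) :
    pathMul p (vertex S G w) * edge S G e ∈ ghostFiltration S G 0 := by
  rw [pathMul_mul]
  by_cases h : w = G.source e
  · subst h
    have : pathMul p (edge S G e) = pathMul (p ++ [e]) (vertex S G (G.range e)) := by
      rw [pathMul_append, pathMul_cons, pathMul_nil, edge_mul_range]
    rw [source_mul_edge, this]
    exact pathMul_mem (hp.append ⟨rfl, rfl⟩)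
  · rw [vertex_mul_edge_of_ne h, pathMul_zero]
    exact zero_mem _

theorem mul_vertex_mem {n : ℕ} {x : LeavittPathAlgebra S G} (hx : x ∈ ghostFiltration S G n)
    (v : V) : x * vertex S G v ∈ ghostFiltration S G n := by
  induction n generalizing x with
  | zero =>
    refine ghostFiltration_zero_induction (C := fun x => x * vertex S G v ∈ ghostFiltration S G 0)
      ?_ ?_ ?_ ?_ hx
    · rw [zero_mul]; exact zero_mem _
    · intro x y hx hy; rw [add_mul]; exact add_mem hx hy
    · intro c x hx; rw [smul_mul_assoc]; exact Submodule.smul_mem _ _ hx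
    · intro u p w hp
      rw [pathMul_mul]
      by_cases h : w = v
      · subst h
        rw [vertex_mul_self]
        exact pathMul_mem hp
      · rw [vertex_mul_of_ne h, pathMul_zero]
        exact zero_mem _
  | succ n ih =>
    refine ghostFiltration_succ_induction
      (C := fun x => x * vertex S G v ∈ ghostFiltration S G (n + 1)) ?_ ?_ ?_ ?_ hx
    · intro x y hx hy; rw [add_mul]; exact add_mem hx hy
    · intro c x hx; rw [smul_mul_assoc]; exact Submodule.smul_mem _ _ hx
    · exact fun x hx => ghostFiltration_le_succ n (ih hx)
    · intro x hx e
      rw [mul_assoc]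
      by_cases h : G.source e = v
      · subst h
        rw [ghost_mul_source]
        exact mul_ghost_mem hx e
      · rw [ghost_mul_vertex_of_ne h, mul_zero]
        exact zero_mem _

/-- A final ghost edge meets `f` in `0` or a vertex, so one ghost edge is absorbed. At level `0` the
truncated `n - 1` is right: a path times an edge is a path or zero. -/
theorem mul_edge_mem_pred {n : ℕ} {x : LeavittPathAlgebra S G} (hx : x ∈ ghostFiltration S G n)
    (f : E) : x * edge S G f ∈ ghostFiltration S G (n - 1) := by
  induction n generalizing x with
  | zero =>
    refine ghostFiltration_zero_induction (C := fun x => x * edge S G f ∈ ghostFiltration S G 0)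
      ?_ ?_ ?_ (fun u p w hp => pathMul_vertex_mul_edge_mem hp f) hx
    · rw [zero_mul]; exact zero_mem _
    · intro x y hx hy; rw [add_mul]; exact add_mem hx hy
    · intro c x hx; rw [smul_mul_assoc]; exact Submodule.smul_mem _ _ hx
  | succ n ih =>
    refine ghostFiltration_succ_induction
      (C := fun x => x * edge S G f ∈ ghostFiltration S G n) ?_ ?_ ?_ ?_ hx
    · intro x y hx hy; rw [add_mul]; exact add_mem hx hy
    · intro c x hx; rw [smul_mul_assoc]; exact Submodule.smul_mem _ _ hx
    · exact fun x hx => ghostFiltration_mono (Nat.sub_le n 1) (ih hx)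
    · intro x hx e
      rw [mul_assoc]
      by_cases h : e = f
      · subst h
        rw [ghost_mul_edge_self]
        exact mul_vertex_mem hx _
      · rw [ghost_mul_edge_of_ne h, mul_zero]
        exact zero_mem _

/-- At a sink, every term ending in a ghost edge is killed, because that ghost edge ends at a
different vertex. -/
theorem mul_vertex_mem_zero {n : ℕ} {x : LeavittPathAlgebra S G}
    (hx : x ∈ ghostFiltration S G n) {v : V} (hv : ∀ e, G.source e ≠ v) :
    x * vertex S G v ∈ ghostFiltration S G 0 := by
  induction n generalizing x with
  | zero => exact mul_vertex_mem hx v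
  | succ n ih =>
    refine ghostFiltration_succ_induction
      (C := fun x => x * vertex S G v ∈ ghostFiltration S G 0) ?_ ?_ (fun x hx => ih hx) ?_ hx
    · intro x y hx hy; rw [add_mul]; exact add_mem hx hy
    · intro c x hx; rw [smul_mul_assoc]; exact Submodule.smul_mem _ _ hx
    · intro x hx e
      rw [mul_assoc, ghost_mul_vertex_of_ne (hv e), mul_zero]
      exact zero_mem _

theorem exists_mem_ghostFiltration (x : LeavittPathAlgebra S G) :
    ∃ n, x ∈ ghostFiltration S G n := by
  induction x using induction_mul_right with
  | zero => exact ⟨0, zero_mem _⟩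
  | add x y hx hy =>
    obtain ⟨n, hx⟩ := hx
    obtain ⟨m, hy⟩ := hy
    exact ⟨max n m, add_mem (ghostFiltration_mono (le_max_left n m) hx)
      (ghostFiltration_mono (le_max_right n m) hy)⟩
  | smul c x hx => exact hx.imp fun n hx => Submodule.smul_mem _ c hx
  | vertex' v => exact ⟨0, pathMul_mem (p := []) rfl⟩
  | edge' e =>
    refine ⟨0, ?_⟩
    have : G.IsPath (G.source e) [e] (G.range e) := ⟨rfl, rfl⟩
    simpa using pathMul_mem (S := S) this
  | ghost' e =>
    refine ⟨1, ?_⟩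
    have := mul_ghost_mem (S := S) (G := G) (pathMul_mem (p := []) (rfl : G.range e = G.range e)) e
    simpa using this
  | mul_vertex x v hx => exact hx.imp fun n hx => mul_vertex_mem hx v
  | mul_edge x e hx => exact hx.elim fun n hx => ⟨n - 1, mul_edge_mem_pred hx e⟩
  | mul_ghost x e hx => exact hx.elim fun n hx => ⟨n + 1, mul_ghost_mem hx e⟩

/-- Finite sums of vertices are right local units; allowing every larger `T'` lets two elements
share one. -/
theorem exists_finset_mul_sum_vertex (x : LeavittPathAlgebra S G) :
    ∃ T : Finset V, ∀ T', T ⊆ T' → x * ∑ v ∈ T', vertex S G v = x := by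
  classical
  have key : ∀ (y : LeavittPathAlgebra S G) (v : V), y * vertex S G v = y →
      ∃ T : Finset V, ∀ T', T ⊆ T' → y * ∑ v ∈ T', vertex S G v = y := fun y v hy => by
    refine ⟨{v}, fun T' hT' => ?_⟩
    rw [← hy, mul_assoc, Finset.mul_sum,
      Finset.sum_eq_single_of_mem v (hT' (Finset.mem_singleton_self v))
        (fun w _ hw => vertex_mul_of_ne hw.symm), vertex_mul_self]
  induction x using induction_mul_right with
  | zero => exact ⟨∅, fun _ _ => zero_mul _⟩
  | add x y hx hy =>
    obtain ⟨T₁, h₁⟩ := hx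
    obtain ⟨T₂, h₂⟩ := hy
    refine ⟨T₁ ∪ T₂, fun T' hT' => ?_⟩
    rw [add_mul, h₁ _ (Finset.union_subset_left hT'), h₂ _ (Finset.union_subset_right hT')]
  | smul c x hx =>
    obtain ⟨T, h⟩ := hx
    exact ⟨T, fun T' hT' => by rw [smul_mul_assoc, h T' hT']⟩
  | vertex' v => exact key _ v (vertex_mul_self v)
  | edge' e => exact key _ _ (edge_mul_range e)
  | ghost' e => exact key _ _ (ghost_mul_source e)
  | mul_vertex x v _ => exact key _ v (by rw [mul_assoc, vertex_mul_self])
  | mul_edge x e _ => exact key _ _ (by rw [mul_assoc, edge_mul_range])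
  | mul_ghost x e _ => exact key _ _ (by rw [mul_assoc, ghost_mul_source])

theorem eq_of_forall_mul_vertex {x y : LeavittPathAlgebra S G}
    (h : ∀ v, x * vertex S G v = y * vertex S G v) : x = y := by
  classical
  obtain ⟨T₁, h₁⟩ := exists_finset_mul_sum_vertex x
  obtain ⟨T₂, h₂⟩ := exists_finset_mul_sum_vertex y
  rw [← h₁ (T₁ ∪ T₂) Finset.subset_union_left, ← h₂ (T₁ ∪ T₂) Finset.subset_union_right,
    Finset.mul_sum, Finset.mul_sum]
  exact Finset.sum_congr rfl fun v _ => h v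

/-! ### Reduction of a nontrivial congruence to vertices. -/

section congruence

variable {ρ : RingCon (LeavittPathAlgebra S G)}

/-- The pair differs after right multiplication by some vertex `v`. If `v` emits edges, `v = ∑ e e*`
shows that it still differs after multiplication by some `e`, which lowers the ghost length; if `v`
is a sink, multiplication by `v` removes all ghosts at once. -/
theorem exists_rel_ne_mem_zero (hG : G.RowFinite) {n : ℕ} {x y : LeavittPathAlgebra S G}
    (hx : x ∈ ghostFiltration S G n) (hy : y ∈ ghostFiltration S G n) (hxy : ρ x y)
    (hne : x ≠ y) :
    ∃ x ∈ ghostFiltration S G 0, ∃ y ∈ ghostFiltration S G 0, ρ x y ∧ x ≠ y := by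
  induction n generalizing x y with
  | zero => exact ⟨x, hx, y, hy, hxy, hne⟩
  | succ n ih =>
    obtain ⟨v, hv⟩ : ∃ v, x * vertex S G v ≠ y * vertex S G v := by
      by_contra! h
      exact hne (eq_of_forall_mul_vertex h)
    by_cases hreg : ∃ e, G.source e = v
    · obtain ⟨e, he⟩ : ∃ e, x * edge S G e ≠ y * edge S G e := by
        by_contra! h
        rw [vertex_eq_sum ⟨hreg, hG v⟩, Finset.mul_sum, Finset.mul_sum] at hv
        exact hv (Finset.sum_congr rfl fun e _ => by rw [← mul_assoc, h, mul_assoc])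
      exact ih (mul_edge_mem_pred hx e) (mul_edge_mem_pred hy e) (ρ.mul hxy (ρ.refl _)) he
    · push Not at hreg
      exact ⟨_, mul_vertex_mem_zero hx hreg, _, mul_vertex_mem_zero hy hreg,
        ρ.mul hxy (ρ.refl _), hv⟩

theorem mul_vertex_mem_span {x : LeavittPathAlgebra S G} (hx : x ∈ ghostFiltration S G 0) (w : V) :
    x * vertex S G w ∈
      Submodule.span S ((fun p => pathMul p (vertex S G w)) '' {p | ∃ u, G.IsPath u p w}) := by
  refine ghostFiltration_zero_induction (C := fun x => x * vertex S G w ∈ Submodule.span S _)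
    ?_ ?_ ?_ ?_ hx
  · rw [zero_mul]; exact zero_mem _
  · intro x y hx hy; rw [add_mul]; exact add_mem hx hy
  · intro c x hx; rw [smul_mul_assoc]; exact Submodule.smul_mem _ _ hx
  · intro u p v hp
    rw [pathMul_mul]
    by_cases h : v = w
    · subst h
      rw [vertex_mul_self]
      exact Submodule.subset_span ⟨p, ⟨u, hp⟩, rfl⟩
    · rw [vertex_mul_of_ne h, pathMul_zero]
      exact zero_mem _

/-- `D` is `z ↦ (p m)* u z m`, with `m` chosen so that `p m` is incomparable with `q m` for each
competitor `q` starting at `u`. Competitors starting elsewhere are killed by the factor `u`. -/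
theorem exists_linearMap_separating (hL : ∀ p, G.IsCycle p → ∃ f, G.IsExit f p) {u w : V}
    {p : List E} (hp : G.IsPath u p w) (T : Finset (List E)) (hT : ∀ q ∈ T, ∃ u, G.IsPath u q w)
    (ρ : RingCon (LeavittPathAlgebra S G)) :
    ∃ (D : LeavittPathAlgebra S G →ₗ[S] LeavittPathAlgebra S G) (v : V),
      (∀ x y, ρ x y → ρ (D x) (D y)) ∧ D (pathMul p (vertex S G w)) = vertex S G v ∧
      ∀ q ∈ T, q ≠ p → D (pathMul q (vertex S G w)) = 0 := by
  classical
  obtain ⟨m, v, hm, h⟩ := exists_forall_not_comparable hL hp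
    (T.filter fun q => q ≠ p ∧ G.IsPath u q w) fun q hq => (Finset.mem_filter.1 hq).2
  have hprod : ∀ q, pathMul q (vertex S G w) * pathMul m (vertex S G v) =
      pathMul (q ++ m) (vertex S G v) := fun q => by
    rw [pathMul_mul, vertex_mul_pathMul hm, pathMul_append]
  refine ⟨ghostMul S G (p ++ m) ∘ₗ LinearMap.mulLeft S (vertex S G u) ∘ₗ
    LinearMap.mulRight S (pathMul m (vertex S G v)), v, fun x y hxy => ?_, ?_, fun q hq hqp => ?_⟩
  · exact rel_ghostMul ρ _ (ρ.mul (ρ.refl (vertex S G u))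
      (ρ.mul hxy (ρ.refl (pathMul m (vertex S G v)))))
  · change ghostMul S G (p ++ m) (vertex S G u * (pathMul p _ * pathMul m _)) = _
    rw [hprod, vertex_mul_pathMul (hp.append hm), ghostMul_pathMul_self (hp.append hm)]
  · change ghostMul S G (p ++ m) (vertex S G u * (pathMul q _ * pathMul m _)) = _
    obtain ⟨u', hq'⟩ := hT q hq
    rw [hprod]
    by_cases hu : u = u'
    · subst hu
      rw [vertex_mul_pathMul (hq'.append hm), ghostMul_pathMul_of_not_comparable (hq'.append hm)
        (h q (Finset.mem_filter.2 ⟨hq, hqp, hq'⟩))]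
    · rw [vertex_mul_pathMul_of_ne (hq'.append hm) hu, map_zero]

theorem exists_rel_smul_vertex (hG : G.RowFinite)
    (hL : ∀ p, G.IsCycle p → ∃ f, G.IsExit f p) {x y : LeavittPathAlgebra S G} (hxy : ρ x y)
    (hne : x ≠ y) : ∃ (a b : S) (v : V), a ≠ b ∧ ρ (a • vertex S G v) (b • vertex S G v) := by
  classical
  obtain ⟨n, hx⟩ := exists_mem_ghostFiltration x
  obtain ⟨m, hy⟩ := exists_mem_ghostFiltration y
  obtain ⟨x, hx, y, hy, hxy, hne⟩ := exists_rel_ne_mem_zero hG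
    (ghostFiltration_mono (le_max_left n m) hx) (ghostFiltration_mono (le_max_right n m) hy)
    hxy hne
  obtain ⟨w, hw⟩ : ∃ w, x * vertex S G w ≠ y * vertex S G w := by
    by_contra! h
    exact hne (eq_of_forall_mul_vertex h)
  -- No linear independence of paths is needed: any coefficient functions `k` and `l` will do, and
  -- they must differ because the combinations do.
  obtain ⟨k, hk, hkx⟩ := (Finsupp.mem_span_image_iff_linearCombination S).1
    (mul_vertex_mem_span hx w)
  obtain ⟨l, hl, hly⟩ := (Finsupp.mem_span_image_iff_linearCombination S).1
    (mul_vertex_mem_span hy w)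
  rw [Finsupp.mem_supported] at hk hl
  obtain ⟨p, hp⟩ : ∃ p, k p ≠ l p := by
    by_contra! h
    exact hw (by rw [← hkx, ← hly, Finsupp.ext h])
  have hT : ∀ q ∈ k.support ∪ l.support, ∃ u, G.IsPath u q w := fun q hq =>
    (Finset.mem_union.1 hq).elim (fun h => hk h) fun h => hl h
  have hpT : p ∈ k.support ∪ l.support := by
    by_contra hp'
    rw [Finset.mem_union, not_or, Finsupp.notMem_support_iff, Finsupp.notMem_support_iff] at hp'
    exact hp (hp'.1.trans hp'.2.symm)
  obtain ⟨u, hpu⟩ := hT p hpT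
  obtain ⟨D, v, hD, hDp, hDq⟩ := exists_linearMap_separating hL hpu _ hT ρ
  have eval : ∀ f : List E →₀ S, f.support ⊆ k.support ∪ l.support →
      D (Finsupp.linearCombination S (fun p => pathMul p (vertex S G w)) f) =
        f p • vertex S G v := fun f hf => by
    rw [Finsupp.linearCombination_apply, Finsupp.sum_of_support_subset f hf _ (by simp), map_sum,
      Finset.sum_eq_single_of_mem p hpT (fun q hq hqp => by rw [map_smul, hDq q hq hqp, smul_zero]),
      map_smul, hDp]
  refine ⟨k p, l p, v, hp, ?_⟩
  rw [← eval k Finset.subset_union_left, ← eval l Finset.subset_union_right, hkx, hly]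
  exact hD _ _ (ρ.mul hxy (ρ.refl _))

/-- Since `v` is idempotent, `c ↦ c v` is multiplicative, so `ρ` pulls back to a congruence `σ` on
`S`; it is not the diagonal, hence relates `1` to `0`. -/
theorem rel_vertex_zero (hS : IsCongruenceSimple S) {a b : S} {v : V} (hab : a ≠ b)
    (h : ρ (a • vertex S G v) (b • vertex S G v)) : ρ (vertex S G v) 0 := by
  have hmul : ∀ c d : S, (c * d) • vertex S G v = c • vertex S G v * d • vertex S G v :=
    fun c d => by rw [smul_mul_smul_comm, vertex_mul_self]
  let σ : RingCon S :=
    { r := fun c d => ρ (c • vertex S G v) (d • vertex S G v)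
      iseqv := ⟨fun _ => ρ.refl _, fun h => ρ.symm h, fun h₁ h₂ => ρ.trans h₁ h₂⟩
      add' := fun h₁ h₂ => by
        rw [add_smul, add_smul]
        exact ρ.add h₁ h₂
      mul' := fun h₁ h₂ => by
        rw [hmul, hmul]
        exact ρ.mul h₁ h₂ }
  rcases (isCongruenceSimple_iff.1 hS).2 σ with h' | h'
  · exact absurd (h' a b h) hab
  · have : ρ ((1 : S) • vertex S G v) ((0 : S) • vertex S G v) := h' 1 0
    rwa [one_smul, zero_smul] at this

/-- Conjugation: `e* s(e) e = r(e)`. -/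
theorem isHereditary_rel_zero (ρ : RingCon (LeavittPathAlgebra S G)) :
    G.IsHereditary {v | ρ (vertex S G v) 0} := by
  intro e he
  have := ρ.mul (ρ.mul (ρ.refl (ghost S G e)) he) (ρ.refl (edge S G e))
  rwa [ghost_mul_source, ghost_mul_edge_self, mul_zero, zero_mul] at this

theorem rel_sum_zero {A ι : Type*} [NonUnitalSemiring A] (ρ : RingCon A) (s : Finset ι)
    (f : ι → A) (h : ∀ i ∈ s, ρ (f i) 0) : ρ (∑ i ∈ s, f i) 0 :=
  Finset.sum_induction f (fun x => ρ x 0) (fun _ _ hx hy => by simpa using ρ.add hx hy)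
    (ρ.refl 0) h

/-- At a regular vertex, `v = ∑ e r(e) e*`, and each summand is related to `0`. -/
theorem isSaturated_rel_zero (ρ : RingCon (LeavittPathAlgebra S G)) :
    G.IsSaturated {v | ρ (vertex S G v) 0} := by
  intro v hv h
  change ρ (vertex S G v) 0
  rw [vertex_eq_sum hv]
  refine rel_sum_zero ρ _ _ fun e he => ?_
  have he' : ρ (vertex S G (G.range e)) 0 := h e (hv.2.mem_toFinset.1 he)
  have := ρ.mul (ρ.mul (ρ.refl (edge S G e)) he') (ρ.refl (ghost S G e))
  rwa [edge_mul_range, mul_zero, zero_mul] at this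

theorem rel_zero_of_forall_vertex (h : ∀ v, ρ (vertex S G v) 0) (x : LeavittPathAlgebra S G) :
    ρ x 0 := by
  obtain ⟨T, hT⟩ := exists_finset_mul_sum_vertex x
  have := ρ.mul (ρ.refl x) (rel_sum_zero ρ T (vertex S G) fun v _ => h v)
  rwa [hT T subset_rfl, mul_zero] at this

end congruence

theorem isCongruenceSimple [Nonempty V] (hG : G.RowFinite) (hS : IsCongruenceSimple S)
    (hH : ∀ H : Set V, G.IsHereditary H → G.IsSaturated H → H = ∅ ∨ H = Set.univ)
    (hL : ∀ p, G.IsCycle p → ∃ f, G.IsExit f p) : IsCongruenceSimple (LeavittPathAlgebra S G) := by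
  have := hS.1
  obtain ⟨v⟩ := ‹Nonempty V›
  refine isCongruenceSimple_iff.2 ⟨⟨_, _, (smul_vertex_injective hG v).ne one_ne_zero⟩,
    fun ρ => or_iff_not_imp_left.2 fun hρ => ?_⟩
  push Not at hρ
  obtain ⟨x, y, hxy, hne⟩ := hρ
  obtain ⟨a, b, u, hab, h⟩ := exists_rel_smul_vertex hG hL hxy hne
  have hu := rel_vertex_zero hS hab h
  rcases hH _ (isHereditary_rel_zero ρ) (isSaturated_rel_zero ρ) with h | h
  · exact absurd (show u ∈ {v | ρ (vertex S G v) 0} from hu) (h ▸ Set.notMem_empty u)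
  · have h0 := rel_zero_of_forall_vertex fun v => Set.eq_univ_iff_forall.1 h v
    exact fun x y => ρ.trans (h0 x) (ρ.symm (h0 y))

end LeavittPathAlgebra

theorem mainTheorem10 {V E S : Type*} [Nonempty V] [CommSemiring S]
    (G : DirGraph V E) (hG : G.RowFinite) :
    IsCongruenceSimple (LeavittPathAlgebra S G) ↔
      (IsFieldSemiring S ∨ Nonempty (S ≃+* BoolSemifield)) ∧
      (∀ H : Set V, G.IsHereditary H → G.IsSaturated H → H = ∅ ∨ H = Set.univ) ∧
      (∀ p : List E, G.IsCycle p → ∃ f, G.IsExit f p) := by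
  rw [← isCongruenceSimple_iff_isFieldSemiring_or_bool]
  exact ⟨fun h => ⟨LeavittPathAlgebra.isCongruenceSimple_coeff hG h,
    fun _ => LeavittPathAlgebra.eq_empty_or_univ_of_isCongruenceSimple hG h,
    fun _ => LeavittPathAlgebra.exists_isExit_of_isCongruenceSimple hG h⟩,
    fun ⟨hS, hH, hL⟩ => LeavittPathAlgebra.isCongruenceSimple hG hS hH hL⟩
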